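/- Consider $L$ qudits of dimension $d\ge 2$ with Hilbert space $(\mathbb{C}^d)^{\otimes L}$, and let $\|\cdot\|$ be the operator norm. For real numbers $\omega=(\omega_1,\dots,\omega_{d^L})$ let $G_\omega$ be the set of all observables (Hermitian operators) whose eigenvalues, counted with multiplicity, are the $\omega_j$, let $w(\omega)=\frac12(\max_j\omega_j-\min_j\omega_j)$, and let $\mathcal N(M,\varepsilon)$ be the $\varepsilon$-covering number of $M$, i.e. the smallest cardinality of a set $Q\subset M$ such that every point of $M$ has distance at most $\varepsilon$ from $Q$. For a set $\mathcal U$ of unitaries and an observable $O$ (the reference observable) put $R_{\mathcal U}(O)=\{U^\dagger O U : U\in\mathcal U\}$. For every $\Delta>0$ there is $\varepsilon_0>0$ such that for all $0<\varepsilon\le\varepsilon_0$, all integers $d\ge2$, $k\ge 0$ and all real $\alpha>0$, $C$, $c>0$ there is $c'>0$ such that for all real $B,\beta$ the following holds for all sufficiently large $L$. Let $\omega$ satisfy $w(\omega)\le C L^\alpha$, and let $\bar\omega_1<\bar\omega_2$ with $\bar\omega_2-\bar\omega_1\ge\Delta$ be such that $$\big|\{j : |\omega_j-\bar\omega_i|\le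 \varepsilon/2\}\big|\ \ge\ e^{cL}\qquad(i=1,2).$$ 1. The $\varepsilon$-covering number of $G_\omega$ is superexponentially large: $\mathcal N(G_\omega,\varepsilon)\ge \exp(e^{c'L})$. 2. Generic elements of $G_\omega$ cannot be reached, even approximately, with polynomial resources. Namely, let $\mathcal U$ be either (a) the set of unitaries implemented by quantum circuits of depth at most $D\le BL^\beta$, where each layer is a product of unitary gates with pairwise disjoint supports of at most $k$ sites; or (b) the set of time-evolution operators $U(T)$, $0\le T\le BL^\beta$, where $i\hbar\,\partial_tU(t)=H(t)U(t)$, $U(0)=1$ (in integral form), for Hamiltonians $H(t)=\sum_{i=1}^K h_i(t)$ with $K\le BL^\beta$ Hermitian terms, each $h_i(t)$ measurable in time, acting on a time-independent set of at most $k$ sites, and with $\|h_i(t)\|/\hbar\le J\le BL^\beta$ for $t\in[0,T]$; here $\hbar>0$, $K$, $J$ and $T$ are fixed. Then: - for every reference observable $O\in G_\omega$, $\ \mathcal N(R_{\mathcal U}(O),\varepsilon)\le \exp(-e^{c'L})\,\mathcal N(G_\omega,\varepsilon)$; - for every reference observable $O$ (with any spectrum), the set of those elements of $G_\omega$ that have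 distance at most $\varepsilon$ from some element of $R_{\mathcal U}(O)$ has (outer) measure at most $\exp(-e^{c'L})$ with respect to the unitarily invariant probability measure on $G_\omega$ (the law of $VAV^\dagger$ with $A\in G_\omega$ fixed and $V$ a Haar-random unitary); - for every reference observable $O$ (with any spectrum), some element of $G_\omega$ has distance greater than $\varepsilon$ from all elements of $R_{\mathcal U}(O)$. -/

import Mathlib

open MeasureTheory Filter
open scoped Matrix NNReal ENNReal Matrix.Norms.L2Operator

noncomputable section

namespace QuditSystem

/-- Basis configurations of `L` qudits of dimension `d`; the Hilbert space `(ℂ^d)^{⊗ L}` is the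
Euclidean space `ℂ^(Config d L)`. -/
abbrev Config (d L : ℕ) : Type := Fin L → Fin d

/-- Operators on the Hilbert space of `L` qudits, written as matrices in the product basis.
The norm on them is the operator norm with respect to the Euclidean norm. -/
abbrev Op (d L : ℕ) : Type := Matrix (Config d L) (Config d L) ℂ

/-- The set `G_ω` of all observables with spectrum `ω`, eigenvalues counted with multiplicity. -/
def observablesWithSpectrum {d L : ℕ} (ω : Fin (d ^ L) → ℝ) : Set (Op d L) :=
  {O | ∃ hO : O.IsHermitian,
    Finset.univ.val.map hO.eigenvalues = Finset.univ.val.map ω}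

/-- The spectral width: half the difference of the largest and the smallest eigenvalue. -/
def spectralWidth {N : ℕ} (ω : Fin N → ℝ) : ℝ := ((⨆ j, ω j) - ⨅ j, ω j) / 2

/-- The number of eigenvalues (with multiplicity) in the closed `r`-neighborhood of `x`. -/
def numEigenvaluesNear {N : ℕ} (ω : Fin N → ℝ) (x r : ℝ) : ℕ :=
  (Finset.univ.filter fun j => |ω j - x| ≤ r).card

/-- `A` acts only on the sites in `S`: it is `a ⊗ 1` for an operator `a` on the qudits in `S`. -/
def ActsOn {d L : ℕ} (S : Finset (Fin L)) (A : Op d L) : Prop :=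
  ∃ a : Matrix (S → Fin d) (S → Fin d) ℂ, ∀ x y : Config d L,
    A x y = if ∀ i, i ∉ S → x i = y i then a (fun i => x i) (fun i => y i) else 0

/-- One layer of a circuit: a product of unitary gates, each acting on at most `k` sites, with
pairwise disjoint supports. -/
def IsLayer {d L : ℕ} (k : ℕ) (U : Op d L) : Prop :=
  ∃ (n : ℕ) (S : Fin n → Finset (Fin L)) (u : Fin n → Op d L),
    (∀ i j, i ≠ j → Disjoint (S i) (S j)) ∧
    (∀ i, (S i).card ≤ k ∧ ActsOn (S i) (u i) ∧ u i ∈ Matrix.unitaryGroup (Config d L) ℂ) ∧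
    U = (List.ofFn u).prod

/-- The unitaries implemented by quantum circuits of depth (at most) `D` that are composed of
`k`-site gates. -/
def circuitUnitaries (d L k D : ℕ) : Set (Op d L) :=
  {U | ∃ W : Fin D → Op d L, (∀ i, IsLayer k (W i)) ∧ U = (List.ofFn W).prod}

/-- The time-evolution operators `U(T)` for time-dependent Hamiltonians `H(t) = ∑ i, h i t` with
`K` terms on `[0, T]`, where the term `h i` acts on a fixed set of at most `k` sites, depends
measurably on time and satisfies `‖h i t‖ / ħ ≤ J`. The Schrödinger equation
`i ħ U' = H U`, `U(0) = 1`, is imposed in integral form, so that `H` need not be continuous. -/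
def evolutionUnitaries (d L k K : ℕ) (ħ J T : ℝ) : Set (Op d L) :=
  {V | ∃ (S : Fin K → Finset (Fin L)) (h : Fin K → ℝ → Op d L) (U : ℝ → Op d L),
    (∀ i, (S i).card ≤ k) ∧
    (∀ i, ∀ t ∈ Set.Icc 0 T, ActsOn (S i) (h i t) ∧ (h i t).IsHermitian ∧ ‖h i t‖ / ħ ≤ J) ∧
    (∀ i, AEStronglyMeasurable (h i) (volume.restrict (Set.Icc 0 T))) ∧
    ContinuousOn U (Set.Icc 0 T) ∧
    (∀ t ∈ Set.Icc 0 T,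
      U t = 1 - (Complex.I / (ħ : ℂ)) • ∫ s in (0 : ℝ)..t, (∑ i, h i s) * U s) ∧
    V = U T}

/-- The evolved observables `U† O U`, where `U` ranges over the set `𝒰`. -/
def evolvedObservables {d L : ℕ} (𝒰 : Set (Op d L)) (O : Op d L) : Set (Op d L) :=
  {A | ∃ U ∈ 𝒰, A = Uᴴ * O * U}

instance unitaryGroup_compactSpace (ι : Type*) [Fintype ι] [DecidableEq ι] :
    CompactSpace (Matrix.unitaryGroup ι ℂ) := by
  refine (isCompact_iff_compactSpace (s := (unitary (Matrix ι ι ℂ) : Set (Matrix ι ι ℂ)))).mp ?_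
  have : ProperSpace (Matrix ι ι ℂ) := FiniteDimensional.proper ℂ _
  refine Metric.isCompact_of_isClosed_isBounded (isClosed_unitary (R := Matrix ι ι ℂ)) ?_
  refine (Metric.isBounded_closedBall (x := (0 : Matrix ι ι ℂ)) (r := 1)).subset fun U hU => ?_
  rw [mem_closedBall_zero_iff]
  cases isEmpty_or_nonempty ι
  · rw [Subsingleton.elim U 0, norm_zero]
    exact zero_le_one
  · exact (CStarRing.norm_of_mem_unitary hU).le

instance unitaryGroup_measurableSpace (ι : Type*) [Fintype ι] [DecidableEq ι] :
    MeasurableSpace (Matrix.unitaryGroup ι ℂ) := borel _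

instance unitaryGroup_borelSpace (ι : Type*) [Fintype ι] [DecidableEq ι] :
    BorelSpace (Matrix.unitaryGroup ι ℂ) := ⟨rfl⟩

/-- The Haar probability measure on the unitary group. -/
def haarProb (ι : Type*) [Fintype ι] [DecidableEq ι] : Measure (Matrix.unitaryGroup ι ℂ) :=
  Measure.haarMeasure ⊤

/-- Generic elements of `G_ω` cannot be reached with the unitaries in `𝒰`, quantitatively with a
small parameter `δ`, and up to accuracy `ε` in operator norm:
* evolving a reference observable with the given spectrum, one needs at most a fraction `δ` of the
  `ε`-covering number of `G_ω` to cover the observables that are reached;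
* whatever the reference observable, the elements of `G_ω` that lie within `ε` of a reached
  observable form a subset of `G_ω` of measure at most `δ`, for the unitarily invariant
  probability measure on `G_ω`, i.e. the law of `V A V†` with `A ∈ G_ω` fixed and `V`
  Haar-distributed;
* whatever the reference observable, some element of `G_ω` is farther than `ε` from every reached
  observable. -/
structure GenericallyUnreachable {d L : ℕ} (ω : Fin (d ^ L) → ℝ) (𝒰 : Set (Op d L)) (ε : ℝ≥0)
    (δ : ℝ) : Prop where
  covering_le : ∀ O ∈ observablesWithSpectrum ω,
    (Metric.coveringNumber ε (evolvedObservables 𝒰 O) : ℝ≥0∞) ≤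
      ENNReal.ofReal δ * (Metric.coveringNumber ε (observablesWithSpectrum ω) : ℝ≥0∞)
  measure_le : ∀ O : Op d L, O.IsHermitian → ∀ A ∈ observablesWithSpectrum ω,
    haarProb (Config d L)
      {V | ∃ B ∈ evolvedObservables 𝒰 O, ‖(V : Op d L) * A * (V : Op d L)ᴴ - B‖ ≤ ε} ≤
      ENNReal.ofReal δ
  exists_unreachable : ∀ O : Op d L, O.IsHermitian → ∃ A ∈ observablesWithSpectrum ω,
    ∀ B ∈ evolvedObservables 𝒰 O, (ε : ℝ) < ‖A - B‖

end QuditSystem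

end

/-! The proof compares a packing of the observables with spectrum `ω` with a count of the available
unitaries.

Packing. Let `n = ⌈exp (c L)⌉` and pair `n` eigenvalues near `ω₁` with `n` near `ω₂`. For each
subset of the pairs, some permutation of the eigenbasis puts the second eigenvalue of a pair in the
place of the first exactly for the pairs in the subset. The resulting `2 ^ n` conjugates are
diagonal in one basis, and any two of them differ by almost `ω₂ - ω₁` in some entry
(`exists_separated_conjugates`). Hence the covering number is at least `2 ^ n`
(`two_pow_le_coveringNumber`), and by Haar invariance a small ball has measure at most `2 ^ (-n)`
(`haarProb_conj_mem_ball_le`).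

Counting. A circuit is a product of polynomially many gates. An evolution is a product of
polynomially many short steps, each determined up to second order by the time integrals of the local
terms. A local operator has boundedly many matrix entries, which are rounded to a polynomially fine
mesh. Errors only add up in products of unitaries, so `exp (poly L)` code words describe all
unitaries to inverse polynomial accuracy. `HasCode` is used instead of nets because it passes to
subsets at the same accuracy.

Conclusion. Conjugation `U ↦ Uᴴ * O * U` is Lipschitz with a polynomial constant, so at most `exp
(poly L)` balls cover what is reached, far fewer than `2 ^ n` (`genericallyUnreachable_of_hasCode`).
-/

namespace QuditSystem

/-! ### Separated conjugates and the Haar measure of balls -/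

section Matrices

variable {ι : Type*} [Fintype ι] [DecidableEq ι]

theorem norm_unitary_conj (U : Matrix.unitaryGroup ι ℂ) (X : Matrix ι ι ℂ) :
    ‖(U : Matrix ι ι ℂ) * X * (U : Matrix ι ι ℂ)ᴴ‖ = ‖X‖ := by
  have h1 := CStarRing.norm_coe_unitary_mul U X
  have h2 := CStarRing.norm_mul_coe_unitary ((U : Matrix ι ι ℂ) * X) (star U)
  rw [← h1, ← h2]
  rfl

theorem norm_unitary_conj' (U : Matrix.unitaryGroup ι ℂ) (X : Matrix ι ι ℂ) :
    ‖(U : Matrix ι ι ℂ)ᴴ * X * (U : Matrix ι ι ℂ)‖ = ‖X‖ := by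
  have := norm_unitary_conj (star U) X
  rwa [Unitary.coe_star, Matrix.star_eq_conjTranspose, Matrix.conjTranspose_conjTranspose] at this

theorem norm_le_one_of_mem_unitaryGroup {U : Matrix ι ι ℂ} (hU : U ∈ Matrix.unitaryGroup ι ℂ) :
    ‖U‖ ≤ 1 := by
  cases isEmpty_or_nonempty ι
  · rw [Subsingleton.elim U 0, norm_zero]
    exact zero_le_one
  · exact (CStarRing.norm_of_mem_unitary hU).le

theorem unitaryGroup_conjTranspose_mul (U : Matrix.unitaryGroup ι ℂ) :
    (U : Matrix ι ι ℂ)ᴴ * (U : Matrix ι ι ℂ) = 1 :=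
  Matrix.mem_unitaryGroup_iff'.1 U.2

theorem unitaryGroup_mul_conjTranspose (U : Matrix.unitaryGroup ι ℂ) :
    (U : Matrix ι ι ℂ) * (U : Matrix ι ι ℂ)ᴴ = 1 :=
  Matrix.mem_unitaryGroup_iff.1 U.2

/-- The unitary permutation matrix that conjugates `X` to `X.submatrix σ σ`. -/
theorem exists_unitary_conj_eq_submatrix (σ : Equiv.Perm ι) :
    ∃ Q : Matrix.unitaryGroup ι ℂ, ∀ X : Matrix ι ι ℂ,
      (Q : Matrix ι ι ℂ)ᴴ * X * (Q : Matrix ι ι ℂ) = X.submatrix σ σ := by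
  have key : ∀ X : Matrix ι ι ℂ,
      ((1 : Matrix ι ι ℂ).submatrix id σ)ᴴ * X * ((1 : Matrix ι ι ℂ).submatrix id σ) =
        X.submatrix σ σ := fun X => by
    ext i j
    simp [Matrix.mul_apply, Matrix.one_apply]
  refine ⟨⟨(1 : Matrix ι ι ℂ).submatrix id σ, ?_⟩, key⟩
  rw [Matrix.mem_unitaryGroup_iff', Matrix.star_eq_conjTranspose]
  have := key 1
  rw [mul_one] at this
  rw [this, Matrix.submatrix_one_equiv]

/-- A diagonalizable observable with `n` eigenvalues near `ω₁` and `n` near `ω₂` has `2 ^ n`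
well-separated unitary conjugates. -/
theorem exists_separated_conjugates (μ : ι → ℝ) (U : Matrix.unitaryGroup ι ℂ) {ω₁ ω₂ r s : ℝ}
    {n : ℕ} (hrs : 0 < s) (hω : s + 2 * r ≤ ω₂ - ω₁)
    (h₁ : n ≤ (Finset.univ.filter fun j => |μ j - ω₁| ≤ r).card)
    (h₂ : n ≤ (Finset.univ.filter fun j => |μ j - ω₂| ≤ r).card)
    {A : Matrix ι ι ℂ}
    (hA : A = (U : Matrix ι ι ℂ) * Matrix.diagonal (fun j => (μ j : ℂ)) * (U : Matrix ι ι ℂ)ᴴ) :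
    ∃ V : Finset (Fin n) → Matrix.unitaryGroup ι ℂ, ∀ a b, a ≠ b →
      s ≤ ‖(V a : Matrix ι ι ℂ)ᴴ * A * V a - (V b : Matrix ι ι ℂ)ᴴ * A * V b‖ := by
  obtain ⟨f₁, hf₁⟩ : ∃ f : Fin n ↪ ι, ∀ m, |μ (f m) - ω₁| ≤ r := by
    obtain ⟨t, ht, hc⟩ := Finset.exists_subset_card_eq h₁
    refine ⟨(t.equivFinOfCardEq hc).symm.toEmbedding.trans (Function.Embedding.subtype _),
      fun m => ?_⟩
    exact (Finset.mem_filter.1 (ht ((t.equivFinOfCardEq hc).symm m).2)).2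
  obtain ⟨f₂, hf₂⟩ : ∃ f : Fin n ↪ ι, ∀ m, |μ (f m) - ω₂| ≤ r := by
    obtain ⟨t, ht, hc⟩ := Finset.exists_subset_card_eq h₂
    refine ⟨(t.equivFinOfCardEq hc).symm.toEmbedding.trans (Function.Embedding.subtype _),
      fun m => ?_⟩
    exact (Finset.mem_filter.1 (ht ((t.equivFinOfCardEq hc).symm m).2)).2
  -- The two eigenvalue windows are disjoint because `ω₂ - ω₁ ≥ s + 2 * r > 2 * r`.
  have hne : ∀ m m', f₁ m ≠ f₂ m' := fun m m' h => by
    have a := hf₁ m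
    have b := hf₂ m'
    rw [h] at a
    rw [abs_le] at a b
    linarith
  have hσ : ∀ a : Finset (Fin n), ∃ σ : Equiv.Perm ι, ∀ m,
      σ (f₁ m) = if m ∈ a then f₂ m else f₁ m := fun a => by
    obtain ⟨σ, hσ⟩ := Equiv.Perm.exists_extending_pair f₁
      (fun m => if m ∈ a then f₂ m else f₁ m) f₁.injective (fun m m' h => by
        by_cases hm : m ∈ a <;> by_cases hm' : m' ∈ a <;>
          simp only [hm, hm', if_true, if_false] at h
        · exact f₂.injective h
        · exact absurd h.symm (hne _ _)
        · exact absurd h (hne _ _)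
        · exact f₁.injective h)
    exact ⟨σ, fun m => hσ m⟩
  choose σ hσ using hσ
  choose Q hQ using exists_unitary_conj_eq_submatrix (ι := ι)
  refine ⟨fun a => U * Q (σ a) * U⁻¹, fun a b hab => ?_⟩
  have hconj : ∀ a, ((U * Q (σ a) * U⁻¹ : Matrix.unitaryGroup ι ℂ) : Matrix ι ι ℂ)ᴴ * A *
      ((U * Q (σ a) * U⁻¹ : Matrix.unitaryGroup ι ℂ) : Matrix ι ι ℂ) =
      (U : Matrix ι ι ℂ) * Matrix.diagonal (fun j => (μ (σ a j) : ℂ)) *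
        (U : Matrix ι ι ℂ)ᴴ := fun a => by
    have h := hQ (σ a) (Matrix.diagonal (fun j => (μ j : ℂ)))
    rw [Matrix.submatrix_diagonal_equiv] at h
    have e : ((U * Q (σ a) * U⁻¹ : Matrix.unitaryGroup ι ℂ) : Matrix ι ι ℂ) =
        (U : Matrix ι ι ℂ) * Q (σ a) * (U : Matrix ι ι ℂ)ᴴ := rfl
    rw [e, hA]
    have hU := unitaryGroup_conjTranspose_mul U
    simp only [Matrix.conjTranspose_mul, Matrix.conjTranspose_conjTranspose]
    calc _ = (U : Matrix ι ι ℂ) * ((Q (σ a) : Matrix ι ι ℂ)ᴴ * (((U : Matrix ι ι ℂ)ᴴ * U) *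
          Matrix.diagonal (fun j => (μ j : ℂ)) * ((U : Matrix ι ι ℂ)ᴴ * U)) * Q (σ a)) *
          (U : Matrix ι ι ℂ)ᴴ := by simp only [mul_assoc]
      _ = _ := by rw [hU, one_mul, mul_one, h]; rfl
  rw [hconj, hconj, ← Matrix.sub_mul, ← Matrix.mul_sub, norm_unitary_conj, Matrix.diagonal_sub,
    Matrix.l2_opNorm_diagonal]
  -- At an index in exactly one of the subsets, the diagonal entries at `f₁ m` lie in different
  -- windows, hence at least `s` apart.
  obtain ⟨m, hm⟩ : ∃ m, ¬ (m ∈ a ↔ m ∈ b) := by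
    by_contra! h
    exact hab (Finset.ext h)
  refine le_trans ?_ (norm_le_pi_norm _ (f₁ m))
  rw [← Complex.ofReal_sub, Complex.norm_real, Real.norm_eq_abs, hσ, hσ]
  have h1 := hf₁ m
  have h2 := hf₂ m
  rw [abs_le] at h1 h2
  by_cases hma : m ∈ a <;> by_cases hmb : m ∈ b
  · exact absurd (iff_of_true hma hmb) hm
  · simp only [hma, hmb, if_true, if_false]
    exact le_trans (by linarith) (le_abs_self _)
  · simp only [hma, hmb, if_true, if_false]
    exact le_trans (by linarith) (neg_le_abs _)
  · exact absurd (iff_of_false hma hmb) hm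

instance haarProb_isProbabilityMeasure : IsProbabilityMeasure (haarProb ι) :=
  ⟨by simpa [haarProb] using
    Measure.haarMeasure_self (K₀ := (⊤ : TopologicalSpace.PositiveCompacts _))
        (G := Matrix.unitaryGroup ι ℂ)⟩

instance haarProb_isMulLeftInvariant : (haarProb ι).IsMulLeftInvariant := by
  unfold haarProb
  infer_instance

/-- If the orbit of `A` contains a large separated family, then a ball has small measure for the
law of `V A Vᴴ`. -/
theorem haarProb_conj_mem_ball_le {κ : Type*} [Fintype κ] {A B : Matrix ι ι ℂ} {r s : ℝ}
    (hrs : 4 * r < s)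
    (hV : ∀ W : Matrix.unitaryGroup ι ℂ, ∃ V : κ → Matrix.unitaryGroup ι ℂ, ∀ a b, a ≠ b →
      s ≤ ‖(V a : Matrix ι ι ℂ)ᴴ * (W * A * (W : Matrix ι ι ℂ)ᴴ) * V a -
        (V b : Matrix ι ι ℂ)ᴴ * (W * A * (W : Matrix ι ι ℂ)ᴴ) * V b‖) :
    Fintype.card κ * haarProb ι
      {V | ‖(V : Matrix ι ι ℂ) * A * (V : Matrix ι ι ℂ)ᴴ - B‖ ≤ r} ≤ 1 := by
  set T : Set (Matrix.unitaryGroup ι ℂ) :=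
    {V | ‖(V : Matrix ι ι ℂ) * A * (V : Matrix ι ι ℂ)ᴴ - B‖ ≤ r} with hT
  rcases T.eq_empty_or_nonempty with h0 | ⟨W, hW⟩
  · simp [h0]
  obtain ⟨V, hV⟩ := hV W
  have hTm : MeasurableSet T := by
    refine IsClosed.measurableSet (isClosed_le ?_ continuous_const)
    have : Continuous fun V : Matrix.unitaryGroup ι ℂ => (V : Matrix ι ι ℂ) :=
      continuous_subtype_val
    have h2 : Continuous fun V : Matrix.unitaryGroup ι ℂ => (V : Matrix ι ι ℂ)ᴴ :=
      this.star
    exact (((this.mul continuous_const).mul h2).sub continuous_const).norm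
  -- If `V a * X` lies in `T`, then `X A Xᴴ` is within `2 * r` of the conjugate of `W A Wᴴ` by `V
  -- a`, since `V a * X` and `W` both bring `A` within `r` of `B`. Two such `a` would contradict `4
  -- * r < s`. The disjoint translates of `T` all have the same Haar measure.
  have hdisj : Pairwise (Function.onFun Disjoint fun a => (fun X => V a * X) ⁻¹' T) := by
    intro a b hab
    rw [Function.onFun, Set.disjoint_left]
    intro X hXa hXb
    have e : ∀ c, V c * X ∈ T → ‖(X : Matrix ι ι ℂ) * A * (X : Matrix ι ι ℂ)ᴴ -
        (V c : Matrix ι ι ℂ)ᴴ * (W * A * (W : Matrix ι ι ℂ)ᴴ) * V c‖ ≤ 2 * r := fun c hc => by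
      rw [hT, Set.mem_ofPred_eq] at hc hW
      have h1 := unitaryGroup_conjTranspose_mul (V c)
      have h3 : (X : Matrix ι ι ℂ) * A * (X : Matrix ι ι ℂ)ᴴ = (V c : Matrix ι ι ℂ)ᴴ *
          ((V c * X : Matrix.unitaryGroup ι ℂ) * A *
            ((V c * X : Matrix.unitaryGroup ι ℂ) : Matrix ι ι ℂ)ᴴ) * V c := by
        rw [Submonoid.coe_mul, Matrix.conjTranspose_mul]
        calc _ = ((V c : Matrix ι ι ℂ)ᴴ * V c) * ((X : Matrix ι ι ℂ) * A * (X : Matrix ι ι ℂ)ᴴ) *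
              ((V c : Matrix ι ι ℂ)ᴴ * V c) := by rw [h1, one_mul, mul_one]
          _ = _ := by simp only [mul_assoc]
      rw [h3, ← Matrix.sub_mul, ← Matrix.mul_sub, norm_unitary_conj']
      calc _ ≤ ‖((V c * X : Matrix.unitaryGroup ι ℂ) : Matrix ι ι ℂ) * A *
            ((V c * X : Matrix.unitaryGroup ι ℂ) : Matrix ι ι ℂ)ᴴ - B‖ +
            ‖(W : Matrix ι ι ℂ) * A * (W : Matrix ι ι ℂ)ᴴ - B‖ := by
            rw [norm_sub_rev ((W : Matrix ι ι ℂ) * A * (W : Matrix ι ι ℂ)ᴴ)]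
            exact norm_sub_le_norm_sub_add_norm_sub _ _ _
        _ ≤ 2 * r := by linarith
    have h1 := e a hXa
    have h2 := e b hXb
    have h3 := hV a b hab
    have h4 := norm_sub_le_norm_sub_add_norm_sub
      ((V a : Matrix ι ι ℂ)ᴴ * (W * A * (W : Matrix ι ι ℂ)ᴴ) * V a)
      ((X : Matrix ι ι ℂ) * A * (X : Matrix ι ι ℂ)ᴴ)
      ((V b : Matrix ι ι ℂ)ᴴ * (W * A * (W : Matrix ι ι ℂ)ᴴ) * V b)
    rw [norm_sub_rev _ ((X : Matrix ι ι ℂ) * A * (X : Matrix ι ι ℂ)ᴴ)] at h4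
    linarith
  calc Fintype.card κ * haarProb ι T = ∑ a : κ, haarProb ι ((fun X => V a * X) ⁻¹' T) := by
        simp [measure_preimage_mul]
    _ = haarProb ι (⋃ a, (fun X => V a * X) ⁻¹' T) := by
        rw [measure_iUnion hdisj fun a => (measurable_const_mul (V a)) hTm, tsum_fintype]
    _ ≤ 1 := prob_le_one

end Matrices

/-! ### Observables with a given spectrum -/

section Spectrum

variable {d L : ℕ}

/-- Observables with spectrum `ω` are unitarily diagonalizable. -/
theorem exists_diagonalization {ω : Fin (d ^ L) → ℝ} {A : Op d L}
    (hA : A ∈ observablesWithSpectrum ω) :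
    ∃ (U : Matrix.unitaryGroup (Config d L) ℂ) (μ : Config d L → ℝ),
      A = (U : Op d L) * Matrix.diagonal (fun j => (μ j : ℂ)) * (U : Op d L)ᴴ ∧
      Finset.univ.val.map μ = Finset.univ.val.map ω := by
  obtain ⟨h, hm⟩ := hA
  exact ⟨h.eigenvectorUnitary, h.eigenvalues, h.spectral_theorem, hm⟩

/-- The eigenvalues with multiplicity are the roots of the characteristic polynomial, which the
conjugation leaves unchanged. -/
theorem mem_observablesWithSpectrum_of_diagonalization {ω : Fin (d ^ L) → ℝ}
    (U : Matrix.unitaryGroup (Config d L) ℂ) {μ : Config d L → ℝ}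
    (hμ : Finset.univ.val.map μ = Finset.univ.val.map ω) :
    (U : Op d L) * Matrix.diagonal (fun j => (μ j : ℂ)) * (U : Op d L)ᴴ ∈
      observablesWithSpectrum ω := by
  have hH : ((U : Op d L) * Matrix.diagonal (fun j => (μ j : ℂ)) * (U : Op d L)ᴴ).IsHermitian :=
    Matrix.isHermitian_mul_mul_conjTranspose _
      (Matrix.isHermitian_diagonal_of_self_adjoint _ (by ext; simp))
  refine ⟨hH, ?_⟩
  rw [← hμ]
  have h1 := hH.roots_charpoly_eq_eigenvalues
  rw [Matrix.charpoly_mul_comm, ← mul_assoc, unitaryGroup_conjTranspose_mul, one_mul,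
    Matrix.charpoly_diagonal, Polynomial.roots_prod _ _
      (Finset.prod_ne_zero_iff.2 fun i _ => Polynomial.X_sub_C_ne_zero _)] at h1
  simp only [Polynomial.roots_X_sub_C, Multiset.bind_singleton] at h1
  have h2 := congrArg (Multiset.map Complex.re) h1
  simpa [Multiset.map_map, Function.comp_def] using h2.symm

theorem observablesWithSpectrum_nonempty (ω : Fin (d ^ L) → ℝ) :
    (observablesWithSpectrum (d := d) (L := L) ω).Nonempty := by
  have e : Config d L ≃ Fin (d ^ L) := Fintype.equivFinOfCardEq (by simp)
  refine ⟨_, mem_observablesWithSpectrum_of_diagonalization 1 (μ := ω ∘ e) ?_⟩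
  rw [← Multiset.map_map, ← Finset.map_univ_equiv e]
  simp

theorem conj_mem_observablesWithSpectrum {ω : Fin (d ^ L) → ℝ} {A : Op d L}
    (hA : A ∈ observablesWithSpectrum ω) (V : Matrix.unitaryGroup (Config d L) ℂ) :
    (V : Op d L) * A * (V : Op d L)ᴴ ∈ observablesWithSpectrum ω := by
  obtain ⟨U, μ, rfl, hμ⟩ := exists_diagonalization hA
  have := mem_observablesWithSpectrum_of_diagonalization (V * U) hμ
  simpa [Matrix.conjTranspose_mul, mul_assoc] using this

theorem conj_mem_observablesWithSpectrum' {ω : Fin (d ^ L) → ℝ} {A : Op d L}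
    (hA : A ∈ observablesWithSpectrum ω) (V : Matrix.unitaryGroup (Config d L) ℂ) :
    (V : Op d L)ᴴ * A * (V : Op d L) ∈ observablesWithSpectrum ω := by
  have := conj_mem_observablesWithSpectrum hA (star V)
  rwa [Unitary.coe_star, Matrix.star_eq_conjTranspose, Matrix.conjTranspose_conjTranspose] at this

theorem card_filter_eq_of_map_eq {ι κ : Type*} [Fintype ι] [Fintype κ] {μ : ι → ℝ} {ω : κ → ℝ}
    (h : Finset.univ.val.map μ = Finset.univ.val.map ω) (p : ℝ → Prop) [DecidablePred p] :
    (Finset.univ.filter fun j => p (μ j)).card = (Finset.univ.filter fun j => p (ω j)).card := by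
  have := congrArg (Multiset.countP p) h
  rwa [Multiset.countP_map, Multiset.countP_map] at this

theorem exists_separated_conjugates_of_mem {ω : Fin (d ^ L) → ℝ} {ω₁ ω₂ r s : ℝ} {n : ℕ}
    (hs : 0 < s) (hω : s + 2 * r ≤ ω₂ - ω₁) (h₁ : n ≤ numEigenvaluesNear ω ω₁ r)
    (h₂ : n ≤ numEigenvaluesNear ω ω₂ r) {A : Op d L} (hA : A ∈ observablesWithSpectrum ω) :
    ∃ V : Finset (Fin n) → Matrix.unitaryGroup (Config d L) ℂ, ∀ a b, a ≠ b →
      s ≤ ‖(V a : Op d L)ᴴ * A * V a - (V b : Op d L)ᴴ * A * V b‖ := by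
  obtain ⟨U, μ, rfl, hμ⟩ := exists_diagonalization hA
  refine exists_separated_conjugates μ U hs hω ?_ ?_ rfl
  · rwa [card_filter_eq_of_map_eq hμ fun x => |x - ω₁| ≤ r]
  · rwa [card_filter_eq_of_map_eq hμ fun x => |x - ω₂| ≤ r]

/-- The midpoint of the spectrum. -/
noncomputable def spectralCenter {N : ℕ} (ω : Fin N → ℝ) : ℝ := ((⨆ j, ω j) + ⨅ j, ω j) / 2

theorem spectralWidth_nonneg {N : ℕ} (ω : Fin N → ℝ) : 0 ≤ spectralWidth ω := by
  unfold spectralWidth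
  have : ⨅ j, ω j ≤ ⨆ j, ω j := by
    cases isEmpty_or_nonempty (Fin N)
    · simp
    · exact ciInf_le_ciSup (Set.finite_range ω).bddBelow (Set.finite_range ω).bddAbove
  linarith

theorem norm_sub_spectralCenter_le {ω : Fin (d ^ L) → ℝ} {A : Op d L}
    (hA : A ∈ observablesWithSpectrum ω) :
    ‖A - (spectralCenter ω : ℂ) • (1 : Op d L)‖ ≤ spectralWidth ω := by
  obtain ⟨U, μ, rfl, hμ⟩ := exists_diagonalization hA
  have h1 : (spectralCenter ω : ℂ) • (1 : Op d L) =
      (U : Op d L) * Matrix.diagonal (fun _ => (spectralCenter ω : ℂ)) * (U : Op d L)ᴴ := by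
    rw [← Matrix.smul_one_eq_diagonal, Matrix.mul_smul, Matrix.smul_mul, mul_one,
      unitaryGroup_mul_conjTranspose]
  rw [h1, ← Matrix.sub_mul, ← Matrix.mul_sub, norm_unitary_conj, Matrix.diagonal_sub,
    Matrix.l2_opNorm_diagonal, pi_norm_le_iff_of_nonneg (spectralWidth_nonneg ω)]
  intro j
  rw [← Complex.ofReal_sub, Complex.norm_real, Real.norm_eq_abs]
  have hj : μ j ∈ Finset.univ.val.map ω := hμ ▸ Multiset.mem_map_of_mem μ (Finset.mem_univ_val j)
  obtain ⟨l, -, hl⟩ := Multiset.mem_map.1 hj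
  have h2 := ciInf_le (Set.finite_range ω).bddBelow l
  have h3 := le_ciSup (Set.finite_range ω).bddAbove l
  rw [← hl, abs_le, spectralWidth, spectralCenter]
  constructor <;> linarith

end Spectrum

/-! ### Codes and covering numbers -/

/-- The set `X` can be encoded by at most `m` code words such that points with the same code word
are within `δ` of each other. -/
def HasCode {E : Type*} [SeminormedAddCommGroup E] (X : Set E) (δ : ℝ) (m : ℕ) : Prop :=
  ∃ (κ : Type) (_ : Fintype κ) (f : E → κ), Fintype.card κ ≤ m ∧
    ∀ x ∈ X, ∀ y ∈ X, f x = f y → ‖x - y‖ ≤ δ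

/-- One representative in `X` is chosen for each code word in use, so that the centers lie in `X`,
as the covering number requires. -/
theorem HasCode.exists_finset {E : Type*} [SeminormedAddCommGroup E] {X : Set E} {δ : ℝ} {m : ℕ}
    (h : HasCode X δ m) :
    ∃ s : Finset E, s.card ≤ m ∧ ↑s ⊆ X ∧ ∀ x ∈ X, ∃ y ∈ s, ‖x - y‖ ≤ δ := by
  classical
  obtain ⟨κ, _, f, hm, hf⟩ := h
  let t : Finset κ := Finset.univ.filter fun c => ∃ x ∈ X, f x = c
  have ht : ∀ c : t, ∃ x ∈ X, f x = c := fun c => (Finset.mem_filter.1 c.2).2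
  choose g hgX hg using ht
  refine ⟨Finset.univ.image g, ?_, ?_, fun x hx => ?_⟩
  · refine Finset.card_image_le.trans ?_
    rw [Finset.card_univ, Fintype.card_coe]
    exact (Finset.card_le_univ t).trans hm
  · intro y hy
    obtain ⟨c, -, rfl⟩ := Finset.mem_image.1 (Finset.mem_coe.1 hy)
    exact hgX c
  · have hc : f x ∈ t := Finset.mem_filter.2 ⟨Finset.mem_univ _, x, hx, rfl⟩
    exact ⟨g ⟨f x, hc⟩, Finset.mem_image_of_mem _ (Finset.mem_univ _),
      hf x hx _ (hgX _) (hg ⟨f x, hc⟩).symm⟩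

theorem HasCode.coveringNumber_le {E : Type*} [SeminormedAddCommGroup E] {X : Set E} {ε : ℝ≥0}
    {m : ℕ} (h : HasCode X ε m) : (Metric.coveringNumber ε X : ℝ≥0∞) ≤ m := by
  obtain ⟨s, hs, hsX, hc⟩ := h.exists_finset
  have h1 : Metric.coveringNumber ε X ≤ (s : Set E).encard := by
    refine Metric.IsCover.coveringNumber_le_encard hsX ?_
    rw [Metric.isCover_iff_subset_iUnion_closedBall]
    intro x hx
    obtain ⟨y, hy, hxy⟩ := hc x hx
    exact Set.mem_iUnion₂.2 ⟨y, hy, by rwa [Metric.mem_closedBall, dist_eq_norm]⟩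
  rw [Set.encard_coe_eq_coe_finsetCard] at h1
  have h2 : Metric.coveringNumber ε X ≤ (m : ℕ∞) := h1.trans (by exact_mod_cast hs)
  exact_mod_cast ENat.toENNReal_le.2 h2

/-- A separated family gives a lower bound on the covering number. -/
theorem card_le_coveringNumber {E κ : Type*} [SeminormedAddCommGroup E] [Fintype κ] {X : Set E}
    {ε : ℝ≥0} (f : κ → E) (hf : ∀ a, f a ∈ X) {s : ℝ} (hs : 2 * ε < s)
    (hsep : ∀ a b, a ≠ b → s ≤ ‖f a - f b‖) :
    (Fintype.card κ : ℝ≥0∞) ≤ (Metric.coveringNumber ε X : ℝ≥0∞) := by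
  have h0 : Function.Injective f := fun a b h => by
    by_contra hab
    have := hsep a b hab
    rw [h, sub_self, norm_zero] at this
    linarith [NNReal.zero_le_coe (q := ε)]
  have h1 : (Set.range f).encard ≤ Metric.packingNumber (2 * ε) X := by
    refine Metric.IsSeparated.encard_le_packingNumber (Set.range_subset_iff.2 hf) ?_
    rintro _ ⟨a, rfl⟩ _ ⟨b, rfl⟩ hab
    have := hsep a b fun h => hab (h ▸ rfl)
    rw [edist_dist, dist_eq_norm, ENNReal.lt_ofReal_iff_toReal_lt (by finiteness)]
    simp only [ENNReal.coe_toReal, NNReal.coe_mul, NNReal.coe_ofNat]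
    linarith
  have h2 := h1.trans ((Metric.packingNumber_two_mul_le_externalCoveringNumber ε X).trans
    (Metric.externalCoveringNumber_le_coveringNumber ε X))
  rw [← Set.image_univ, h0.encard_image, Set.encard_univ, ENat.card_eq_coe_fintype_card] at h2
  exact_mod_cast ENat.toENNReal_le.2 h2

/-! ### From few code words to unreachability -/

section Unreachable

variable {d L : ℕ}

/-- Subtracting a scalar from `O` does not change the difference of its conjugates. The Lipschitz
constant is therefore controlled by the spectral width and not by the norm of `O`. -/
theorem norm_conj_sub_conj_le {U V : Op d L} (hU : U ∈ Matrix.unitaryGroup (Config d L) ℂ)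
    (hV : V ∈ Matrix.unitaryGroup (Config d L) ℂ) (O : Op d L) (c : ℂ) {w δ : ℝ}
    (hO : ‖O - c • (1 : Op d L)‖ ≤ w) (hUV : ‖U - V‖ ≤ δ) :
    ‖Uᴴ * O * U - Vᴴ * O * V‖ ≤ 2 * w * δ := by
  have e : ∀ W ∈ Matrix.unitaryGroup (Config d L) ℂ,
      Wᴴ * O * W = Wᴴ * (O - c • (1 : Op d L)) * W + c • (1 : Op d L) := fun W hW => by
    have := unitaryGroup_conjTranspose_mul ⟨W, hW⟩
    rw [Matrix.mul_sub, Matrix.sub_mul, Matrix.mul_smul, Matrix.smul_mul, mul_one, this,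
      sub_add_cancel]
  rw [e U hU, e V hV, add_sub_add_right_eq_sub]
  set X := O - c • (1 : Op d L)
  have h1 : Uᴴ * X * U - Vᴴ * X * V = (U - V)ᴴ * X * U + Vᴴ * X * (U - V) := by
    rw [Matrix.conjTranspose_sub]
    noncomm_ring
  have hw : 0 ≤ w := (norm_nonneg _).trans hO
  have hδ : 0 ≤ δ := (norm_nonneg _).trans hUV
  have hU1 := norm_le_one_of_mem_unitaryGroup hU
  have hV1 := norm_le_one_of_mem_unitaryGroup hV
  rw [h1]
  calc _ ≤ ‖(U - V)ᴴ‖ * ‖X‖ * ‖U‖ + ‖Vᴴ‖ * ‖X‖ * ‖U - V‖ :=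
        norm_add_le_of_le (norm_mul₃_le) (norm_mul₃_le)
    _ ≤ δ * w * 1 + 1 * w * δ := by
        rw [Matrix.l2_opNorm_conjTranspose, Matrix.l2_opNorm_conjTranspose]
        gcongr
    _ = 2 * w * δ := by ring

theorem two_pow_le_coveringNumber {ω : Fin (d ^ L) → ℝ} {ω₁ ω₂ : ℝ} {ε : ℝ≥0}
    {n : ℕ} (hε : 0 < ε) (hω : 10 * ε ≤ ω₂ - ω₁)
    (h₁ : n ≤ numEigenvaluesNear ω ω₁ (ε / 2)) (h₂ : n ≤ numEigenvaluesNear ω ω₂ (ε / 2)) :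
    (2 ^ n : ℝ≥0∞) ≤
      (Metric.coveringNumber ε (observablesWithSpectrum (d := d) (L := L) ω) : ℝ≥0∞) := by
  have hε' : (0 : ℝ) < ε := hε
  obtain ⟨A, hA⟩ := observablesWithSpectrum_nonempty (d := d) (L := L) ω
  -- The gap `10 * ε` minus twice the window radius `ε / 2` leaves a separation of `9 * ε`. The
  -- measure estimate needs more than `8 * ε`, for balls of radius `2 * ε`.
  obtain ⟨V, hV⟩ := exists_separated_conjugates_of_mem (s := 9 * ε) (by positivity)
    (by linarith) h₁ h₂ hA
  have := card_le_coveringNumber (ε := ε) (fun a => (V a : Op d L)ᴴ * A * V a)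
    (fun a => conj_mem_observablesWithSpectrum' hA (V a)) (by linarith) hV
  rwa [Fintype.card_finset, Fintype.card_fin, Nat.cast_pow, Nat.cast_ofNat] at this

/-- A set of unitaries that can be encoded with few code words cannot reach generic observables
of a given spectrum that has large groups of eigenvalues near two distinct values. -/
theorem genericallyUnreachable_of_hasCode {ω : Fin (d ^ L) → ℝ} {ω₁ ω₂ η δ : ℝ} {ε : ℝ≥0}
    {n m : ℕ} (hε : 0 < ε) (hω : 10 * ε ≤ ω₂ - ω₁)
    (h₁ : n ≤ numEigenvaluesNear ω ω₁ (ε / 2)) (h₂ : n ≤ numEigenvaluesNear ω ω₂ (ε / 2))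
    {𝒰 : Set (Op d L)} (h𝒰 : 𝒰 ⊆ Matrix.unitaryGroup (Config d L) ℂ) (hcode : HasCode 𝒰 η m)
    (hη : 2 * (spectralWidth ω + ε) * η ≤ ε) (hδ : δ < 1) (hm : (m : ℝ) ≤ δ * 2 ^ n) :
    GenericallyUnreachable ω 𝒰 ε δ := by
  have hε' : (0 : ℝ) < ε := hε
  have hsep := fun {A : Op d L} (hA : A ∈ observablesWithSpectrum ω) =>
    exists_separated_conjugates_of_mem (s := 9 * ε) (by positivity) (by linarith) h₁ h₂ hA
  have hmM : (m : ℝ≥0∞) ≤ ENNReal.ofReal δ * 2 ^ n := by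
    have := ENNReal.ofReal_le_ofReal hm
    rwa [ENNReal.ofReal_natCast, ENNReal.ofReal_mul' (by positivity),
      ENNReal.ofReal_pow (by norm_num), ENNReal.ofReal_ofNat] at this
  have hmeas : ∀ O : Op d L, O.IsHermitian → ∀ A ∈ observablesWithSpectrum ω,
      haarProb (Config d L)
        {V | ∃ B ∈ evolvedObservables 𝒰 O, ‖(V : Op d L) * A * (V : Op d L)ᴴ - B‖ ≤ ε} ≤
        ENNReal.ofReal δ := by
    intro O _ A hA
    have hball : ∀ B : Op d L, haarProb (Config d L)
        {V | ‖(V : Op d L) * A * (V : Op d L)ᴴ - B‖ ≤ 2 * ε} ≤ (2 ^ n)⁻¹ := fun B => by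
      have := haarProb_conj_mem_ball_le (κ := Finset (Fin n)) (A := A) (B := B) (r := 2 * ε)
        (s := 9 * ε) (by linarith) fun W => hsep (conj_mem_observablesWithSpectrum hA W)
      rw [Fintype.card_finset, Fintype.card_fin, Nat.cast_pow, Nat.cast_ofNat] at this
      rw [ENNReal.le_inv_iff_mul_le, mul_comm]
      exact this
    -- The reference observable `O` may be arbitrarily large, but only unitaries bringing it within
    -- `ε` of the orbit of `A` matter. If there is one, `O` is within `spectralWidth ω + ε` of the
    -- scalar `spectralCenter ω`.
    let 𝒱 : Set (Op d L) := {U | U ∈ 𝒰 ∧ ∃ V : Matrix.unitaryGroup (Config d L) ℂ,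
      ‖(V : Op d L) * A * (V : Op d L)ᴴ - Uᴴ * O * U‖ ≤ ε}
    have hO : ∀ U ∈ 𝒱, ‖O - (spectralCenter ω : ℂ) • (1 : Op d L)‖ ≤ spectralWidth ω + ε := by
      rintro U ⟨hU, V, hV⟩
      have h1 := norm_sub_spectralCenter_le (conj_mem_observablesWithSpectrum hA V)
      have hU' := unitaryGroup_conjTranspose_mul ⟨U, h𝒰 hU⟩
      rw [← norm_unitary_conj' ⟨U, h𝒰 hU⟩]
      have e : (U)ᴴ * (O - (spectralCenter ω : ℂ) • (1 : Op d L)) * U =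
          Uᴴ * O * U - (spectralCenter ω : ℂ) • (1 : Op d L) := by
        rw [Matrix.mul_sub, Matrix.sub_mul, Matrix.mul_smul, Matrix.smul_mul, mul_one, hU']
      rw [e, add_comm]
      refine (norm_sub_le_norm_sub_add_norm_sub _ ((V : Op d L) * A * (V : Op d L)ᴴ) _).trans ?_
      rw [norm_sub_rev (Uᴴ * O * U)]
      exact add_le_add hV h1
    have hcode' : HasCode 𝒱 η m := by
      obtain ⟨κ, hκ, f, hc, hf⟩ := hcode
      exact ⟨κ, hκ, f, hc, fun x hx y hy => hf x hx.1 y hy.1⟩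
    obtain ⟨t, ht, ht𝒱, hcov⟩ := hcode'.exists_finset
    calc haarProb (Config d L)
          {V | ∃ B ∈ evolvedObservables 𝒰 O, ‖(V : Op d L) * A * (V : Op d L)ᴴ - B‖ ≤ ε}
        ≤ haarProb (Config d L) (⋃ U ∈ t,
          {V | ‖(V : Op d L) * A * (V : Op d L)ᴴ - Uᴴ * O * U‖ ≤ 2 * ε}) := by
          refine measure_mono ?_
          rintro V ⟨_, ⟨U, hU, rfl⟩, hV⟩
          obtain ⟨U', hU', hUU'⟩ := hcov U ⟨hU, V, hV⟩
          refine Set.mem_iUnion₂.2 ⟨U', hU', ?_⟩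
          have := norm_conj_sub_conj_le (h𝒰 hU) (h𝒰 (ht𝒱 hU').1) O _ (hO U ⟨hU, V, hV⟩) hUU'
          -- One `ε` comes from approximate reachability, the other from replacing `U` by the center
          -- `U'`.
          refine (norm_sub_le_norm_sub_add_norm_sub _ (Uᴴ * O * U) _).trans ?_
          rw [two_mul]
          exact add_le_add hV (this.trans hη)
      _ ≤ ∑ U ∈ t, haarProb (Config d L)
          {V | ‖(V : Op d L) * A * (V : Op d L)ᴴ - Uᴴ * O * U‖ ≤ 2 * ε} :=
          measure_biUnion_finset_le _ _
      _ ≤ ∑ U ∈ t, (2 ^ n)⁻¹ := Finset.sum_le_sum fun U _ => hball _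
      _ = t.card * (2 ^ n)⁻¹ := by rw [Finset.sum_const, nsmul_eq_mul]
      _ ≤ m * (2 ^ n)⁻¹ := by gcongr
      _ ≤ ENNReal.ofReal δ * 2 ^ n * (2 ^ n)⁻¹ := by gcongr
      _ = ENNReal.ofReal δ := by
          rw [mul_assoc, ENNReal.mul_inv_cancel (by positivity) (by finiteness), mul_one]
  refine ⟨fun O hO => ?_, hmeas, fun O hO => ?_⟩
  · have h1 : HasCode (evolvedObservables 𝒰 O) ε m := by
      obtain ⟨κ, hκ, f, hc, hf⟩ := hcode
      have : Nonempty (Op d L) := ⟨0⟩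
      let g : Op d L → Op d L := fun A => Classical.epsilon fun U => U ∈ 𝒰 ∧ A = Uᴴ * O * U
      have hg : ∀ A ∈ evolvedObservables 𝒰 O, g A ∈ 𝒰 ∧ A = (g A)ᴴ * O * g A := fun A hA => by
        obtain ⟨U, hU, e⟩ := hA
        exact Classical.epsilon_spec (p := fun U => U ∈ 𝒰 ∧ A = Uᴴ * O * U) ⟨U, hU, e⟩
      refine ⟨κ, hκ, f ∘ g, hc, fun x hx y hy hxy => ?_⟩
      obtain ⟨hx1, hx2⟩ := hg x hx
      obtain ⟨hy1, hy2⟩ := hg y hy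
      rw [hx2, hy2]
      refine (norm_conj_sub_conj_le (h𝒰 hx1) (h𝒰 hy1) O _
        ((norm_sub_spectralCenter_le hO).trans ?_) (hf _ hx1 _ hy1 hxy)).trans hη
      linarith
    have h2 := two_pow_le_coveringNumber hε hω h₁ h₂
    exact h1.coveringNumber_le.trans (hmM.trans (by gcongr))
  · obtain ⟨A, hA⟩ := observablesWithSpectrum_nonempty (d := d) (L := L) ω
    -- Otherwise the approximately reached set has measure one, which exceeds `δ`.
    by_contra! hcon
    have h1 := hmeas O hO A hA
    have h2 : {V : Matrix.unitaryGroup (Config d L) ℂ | ∃ B ∈ evolvedObservables 𝒰 O,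
        ‖(V : Op d L) * A * (V : Op d L)ᴴ - B‖ ≤ ε} = Set.univ :=
      Set.eq_univ_of_forall fun V => hcon _ (conj_mem_observablesWithSpectrum hA V)
    rw [h2, measure_univ, ENNReal.one_le_ofReal] at h1
    linarith

end Unreachable

/-! ### Operations on codes -/

section Codes

variable {E F G : Type*} [SeminormedAddCommGroup E] [SeminormedAddCommGroup F]
  [SeminormedAddCommGroup G]

theorem HasCode.mono {X Y : Set E} {δ δ' : ℝ} {m m' : ℕ} (h : HasCode Y δ m) (hX : X ⊆ Y)
    (hδ : δ ≤ δ') (hm : m ≤ m') : HasCode X δ' m' := by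
  obtain ⟨κ, hκ, f, hc, hf⟩ := h
  exact ⟨κ, hκ, f, hc.trans hm, fun x hx y hy hxy => (hf x (hX hx) y (hX hy) hxy).trans hδ⟩

/-- Transfer of codes along an approximate surjection that does not increase distances. -/
theorem HasCode.of_approx {X : Set E} {Y : Set F} {δ ρ : ℝ} {m : ℕ} (h : HasCode Y δ m)
    (φ : F → E) (hφ : ∀ y ∈ Y, ∀ y' ∈ Y, ‖φ y - φ y'‖ ≤ ‖y - y'‖)
    (hX : ∀ x ∈ X, ∃ y ∈ Y, ‖x - φ y‖ ≤ ρ) : HasCode X (δ + 2 * ρ) m := by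
  obtain ⟨κ, hκ, f, hc, hf⟩ := h
  let g : E → F := fun x => Classical.epsilon fun y => y ∈ Y ∧ ‖x - φ y‖ ≤ ρ
  have hg : ∀ x ∈ X, g x ∈ Y ∧ ‖x - φ (g x)‖ ≤ ρ := fun x hx => by
    obtain ⟨y, hy⟩ := hX x hx
    exact Classical.epsilon_spec (p := fun y => y ∈ Y ∧ ‖x - φ y‖ ≤ ρ) ⟨y, hy⟩
  refine ⟨κ, hκ, f ∘ g, hc, fun x hx y hy hxy => ?_⟩
  obtain ⟨hx1, hx2⟩ := hg x hx
  obtain ⟨hy1, hy2⟩ := hg y hy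
  have h1 := (hφ _ hx1 _ hy1).trans (hf _ hx1 _ hy1 hxy)
  have h2 := norm_sub_le_norm_sub_add_norm_sub x (φ (g x)) y
  have h3 := norm_sub_le_norm_sub_add_norm_sub (φ (g x)) (φ (g y)) y
  rw [norm_sub_rev (φ (g y))] at h3
  linarith

/-- Each point of the image is encoded by the pair of code words of one chosen preimage. -/
theorem HasCode.image2 {X : Set E} {Y : Set F} {δ δ' : ℝ} {m m' : ℕ} (h : HasCode X δ m)
    (h' : HasCode Y δ' m') (φ : E → F → G) (hφ : ∀ x ∈ X, ∀ x' ∈ X, ∀ y ∈ Y, ∀ y' ∈ Y,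
      ‖φ x y - φ x' y'‖ ≤ ‖x - x'‖ + ‖y - y'‖) :
    HasCode (Set.image2 φ X Y) (δ + δ') (m * m') := by
  obtain ⟨κ, hκ, f, hc, hf⟩ := h
  obtain ⟨κ', hκ', f', hc', hf'⟩ := h'
  let g : G → E × F := fun z => Classical.epsilon fun p => p.1 ∈ X ∧ p.2 ∈ Y ∧ φ p.1 p.2 = z
  have hg : ∀ z ∈ Set.image2 φ X Y, (g z).1 ∈ X ∧ (g z).2 ∈ Y ∧ φ (g z).1 (g z).2 = z := by
    rintro z ⟨x, hx, y, hy, hz⟩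
    exact Classical.epsilon_spec (p := fun p : E × F => p.1 ∈ X ∧ p.2 ∈ Y ∧ φ p.1 p.2 = z)
      ⟨(x, y), hx, hy, hz⟩
  refine ⟨κ × κ', inferInstance, fun z => (f (g z).1, f' (g z).2), ?_, fun x hx y hy hxy => ?_⟩
  · rw [Fintype.card_prod]
    exact Nat.mul_le_mul hc hc'
  · obtain ⟨hx1, hx2, hx3⟩ := hg x hx
    obtain ⟨hy1, hy2, hy3⟩ := hg y hy
    rw [Prod.mk.injEq] at hxy
    rw [← hx3, ← hy3]
    exact (hφ _ hx1 _ hy1 _ hx2 _ hy2).trans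
      (add_le_add (hf _ hx1 _ hy1 hxy.1) (hf' _ hx2 _ hy2 hxy.2))

theorem HasCode.iUnion {I : Type} [Fintype I] [Nonempty I] {X : I → Set E} {δ : ℝ} {m : ℕ}
    (h : ∀ i, HasCode (X i) δ m) : HasCode (⋃ i, X i) δ (Fintype.card I * m) := by
  choose κ hκ f hc hf using h
  let g : E → I := fun x => Classical.epsilon fun i => x ∈ X i
  have hg : ∀ x ∈ ⋃ i, X i, x ∈ X (g x) := fun x hx =>
    Classical.epsilon_spec (p := fun i => x ∈ X i) (Set.mem_iUnion.1 hx)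
  refine ⟨Σ i, κ i, inferInstance, fun x => ⟨g x, f (g x) x⟩, ?_, fun x hx y hy hxy => ?_⟩
  · rw [Fintype.card_sigma]
    calc _ ≤ ∑ _i : I, m := Finset.sum_le_sum fun i _ => hc i
      _ = _ := by simp
  · have hx1 := hg x hx
    have hy1 := hg y hy
    simp only at hxy
    generalize g x = i at hxy hx1
    generalize g y = j at hxy hy1
    obtain ⟨rfl, h2⟩ := Sigma.mk.inj_iff.1 hxy
    exact hf i x hx1 y hy1 (eq_of_heq h2)

open scoped Pointwise in
-- Here `N • X` is the `N`-fold sumset, not the dilate.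
theorem HasCode.nsmul {X : Set E} {δ : ℝ} {m : ℕ} (h : HasCode X δ m) (N : ℕ) :
    HasCode (N • X) (N * δ) (m ^ N) := by
  induction N with
  | zero =>
    refine ⟨Unit, inferInstance, fun _ => (), by simp, fun x hx y hy _ => ?_⟩
    rw [zero_nsmul] at hx hy
    rw [Set.mem_zero.1 hx, Set.mem_zero.1 hy]
    simp
  | succ N ih =>
    rw [succ_nsmul, ← Set.image2_add]
    refine (ih.image2 h (· + ·) fun x _ x' _ y _ y' _ => ?_).mono subset_rfl
      (by push_cast; linarith) (pow_succ m N).ge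
    rw [add_sub_add_comm]
    exact norm_add_le _ _

theorem hasCode_Icc {ρ h : ℝ} (hh : 0 < h) :
    HasCode (Set.Icc (-ρ) ρ) h (⌊2 * ρ / h⌋₊ + 1) := by
  refine ⟨Fin (⌊2 * ρ / h⌋₊ + 1), inferInstance, fun x => Fin.ofNat _ ⌊(x + ρ) / h⌋₊, by simp,
    fun x hx y hy hxy => ?_⟩
  -- The bin numbers stay below the modulus in `Fin.ofNat`, so distinct bins are never identified.
  have hlt : ∀ z ∈ Set.Icc (-ρ) ρ, ⌊(z + ρ) / h⌋₊ < ⌊2 * ρ / h⌋₊ + 1 := fun z hz => by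
    refine Nat.lt_succ_of_le (Nat.floor_le_floor ?_)
    have := hz.2
    gcongr
    linarith
  have he := congrArg Fin.val hxy
  simp only [Fin.val_ofNat] at he
  rw [Nat.mod_eq_of_lt (hlt x hx), Nat.mod_eq_of_lt (hlt y hy)] at he
  have hx0 : 0 ≤ (x + ρ) / h := div_nonneg (by linarith [hx.1]) hh.le
  have hy0 : 0 ≤ (y + ρ) / h := div_nonneg (by linarith [hy.1]) hh.le
  have a1 := Nat.floor_le hx0
  have a2 := Nat.lt_floor_add_one ((x + ρ) / h)
  have b1 := Nat.floor_le hy0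
  have b2 := Nat.lt_floor_add_one ((y + ρ) / h)
  rw [he] at a1 a2
  have c1 : (x + ρ) / h - (y + ρ) / h ≤ 1 := by linarith
  have c2 : (y + ρ) / h - (x + ρ) / h ≤ 1 := by linarith
  rw [← sub_div, div_le_one hh] at c1 c2
  rw [Real.norm_eq_abs, abs_le]
  constructor <;> linarith

theorem hasCode_complex {ρ h : ℝ} (hh : 0 < h) :
    HasCode {z : ℂ | ‖z‖ ≤ ρ} (2 * h) ((⌊2 * ρ / h⌋₊ + 1) ^ 2) := by
  refine ((hasCode_Icc (ρ := ρ) hh).image2 (hasCode_Icc (ρ := ρ) hh)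
    (fun x y : ℝ => (x + y * Complex.I : ℂ)) fun x _ x' _ y _ y' _ => ?_).mono (fun z hz => ?_)
    (by linarith) (sq _).ge
  · rw [add_sub_add_comm, ← sub_mul, ← Complex.ofReal_sub, ← Complex.ofReal_sub]
    refine (norm_add_le _ _).trans ?_
    rw [norm_mul, Complex.norm_I, mul_one, Complex.norm_real, Complex.norm_real]
  · have hz' : ‖z‖ ≤ ρ := hz
    exact ⟨z.re, abs_le.1 ((Complex.abs_re_le_norm z).trans hz'), z.im,
      abs_le.1 ((Complex.abs_im_le_norm z).trans hz'), Complex.re_add_im z⟩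

end Codes

/-! ### Products of unitaries -/

section UnitaryProducts

variable {ι : Type*} [Fintype ι] [DecidableEq ι]

open scoped Pointwise

theorem pow_subset_unitaryGroup {X : Set (Matrix ι ι ℂ)}
    (hX : X ⊆ (Matrix.unitaryGroup ι ℂ : Set (Matrix ι ι ℂ))) (N : ℕ) :
    X ^ N ⊆ (Matrix.unitaryGroup ι ℂ : Set (Matrix ι ι ℂ)) := by
  induction N with
  | zero =>
    intro x hx
    rw [pow_zero] at hx
    rw [Set.mem_one.1 hx]
    exact one_mem _
  | succ N ih =>
    rw [pow_succ]
    rintro _ ⟨x, hx, y, hy, rfl⟩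
    exact mul_mem (ih hx) (hX hy)

/-- Unitary factors have norm at most one, so replacing the factors one at a time makes the errors
add without amplification. -/
theorem HasCode.pow {X : Set (Matrix ι ι ℂ)}
    (hX : X ⊆ (Matrix.unitaryGroup ι ℂ : Set (Matrix ι ι ℂ))) {δ : ℝ} {m : ℕ}
    (h : HasCode X δ m) (N : ℕ) : HasCode (X ^ N) (N * δ) (m ^ N) := by
  induction N with
  | zero =>
    refine ⟨Unit, inferInstance, fun _ => (), by simp, fun x hx y hy _ => ?_⟩
    rw [pow_zero] at hx hy
    rw [Set.mem_one.1 hx, Set.mem_one.1 hy]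
    simp
  | succ N ih =>
    rw [pow_succ, ← Set.image2_mul]
    refine (ih.image2 h (· * ·) fun x _ x' hx' y hy y' _ => ?_).mono subset_rfl
      (by push_cast; linarith) (pow_succ m N).ge
    have h1 : x * y - x' * y' = (x - x') * y + x' * (y - y') := by noncomm_ring
    have h2 := norm_le_one_of_mem_unitaryGroup (hX hy)
    have h3 := norm_le_one_of_mem_unitaryGroup (pow_subset_unitaryGroup hX N hx')
    rw [h1]
    calc _ ≤ ‖x - x'‖ * ‖y‖ + ‖x'‖ * ‖y - y'‖ :=
          norm_add_le_of_le (norm_mul_le _ _) (norm_mul_le _ _)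
      _ ≤ ‖x - x'‖ * 1 + 1 * ‖y - y'‖ := by gcongr
      _ = _ := by ring

theorem norm_entry_le_l2_opNorm (A : Matrix ι ι ℂ) (i j : ι) : ‖A i j‖ ≤ ‖A‖ := by
  have h := Matrix.l2_opNorm_mulVec A (EuclideanSpace.single j (1 : ℂ))
  rw [PiLp.norm_single, norm_one, mul_one] at h
  refine le_trans ?_ h
  have h2 := PiLp.norm_apply_le (WithLp.toLp 2 (A *ᵥ (EuclideanSpace.single j (1 : ℂ)).ofLp)) i
  simpa using h2

end UnitaryProducts

/-! ### Operators on few sites -/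

section Local

variable {d L : ℕ}

/-- The operator `a ⊗ 1` on all sites, for an operator `a` on the sites in `S`. -/
noncomputable def embed (S : Finset (Fin L)) (a : Matrix (S → Fin d) (S → Fin d) ℂ) : Op d L :=
  Matrix.of fun x y => if ∀ i, i ∉ S → x i = y i then a (fun i => x i) (fun i => y i) else 0

theorem embed_apply (S : Finset (Fin L)) (a : Matrix (S → Fin d) (S → Fin d) ℂ)
    (x y : Config d L) :
    embed S a x y =
      if ∀ i, i ∉ S → x i = y i then a (fun i => x i) (fun i => y i) else 0 := rfl

theorem actsOn_iff {S : Finset (Fin L)} {A : Op d L} : ActsOn S A ↔ ∃ a, A = embed S a :=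
  ⟨fun ⟨a, h⟩ => ⟨a, Matrix.ext h⟩, fun ⟨a, h⟩ => ⟨a, fun x y => by rw [h, embed_apply]⟩⟩

open scoped Kronecker in
theorem embed_eq_submatrix (S : Finset (Fin L)) (a : Matrix (S → Fin d) (S → Fin d) ℂ) :
    embed S a = (a ⊗ₖ (1 : Matrix ({i // i ∉ S} → Fin d) ({i // i ∉ S} → Fin d) ℂ)).submatrix
      (Equiv.piEquivPiSubtypeProd (· ∈ S) fun _ => Fin d)
      (Equiv.piEquivPiSubtypeProd (· ∈ S) fun _ => Fin d) := by
  ext x y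
  rw [embed_apply, Matrix.submatrix_apply, Matrix.kroneckerMap_apply, Matrix.one_apply, mul_ite,
    mul_one, mul_zero]
  simp only [Equiv.piEquivPiSubtypeProd_apply, funext_iff, Subtype.forall]

theorem embed_mul (S : Finset (Fin L)) (a b : Matrix (S → Fin d) (S → Fin d) ℂ) :
    embed S a * embed S b = embed S (a * b) := by
  rw [embed_eq_submatrix, embed_eq_submatrix, embed_eq_submatrix, Matrix.submatrix_mul_equiv,
    ← Matrix.mul_kronecker_mul, mul_one]

theorem embed_conjTranspose (S : Finset (Fin L)) (a : Matrix (S → Fin d) (S → Fin d) ℂ) :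
    (embed S a)ᴴ = embed S aᴴ := by
  rw [embed_eq_submatrix, embed_eq_submatrix, Matrix.conjTranspose_submatrix,
    Matrix.conjTranspose_kronecker, Matrix.conjTranspose_one]

/-- `embed S` as a linear map. -/
noncomputable def embedₗ (S : Finset (Fin L)) :
    Matrix (S → Fin d) (S → Fin d) ℂ →ₗ[ℂ] Op d L where
  toFun := embed S
  map_add' a b := by
    ext x y
    simp only [embed_apply, Matrix.add_apply]
    split_ifs <;> simp
  map_smul' c a := by
    ext x y
    simp only [embed_apply, Matrix.smul_apply, RingHom.id_apply]
    split_ifs <;> simp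

/-- By the C*-identity it suffices to bound `Xᴴ * X`, which is diagonal with entries `star c * c` or
`0`. -/
theorem norm_embed_single_le (S : Finset (Fin L)) (u v : S → Fin d) (c : ℂ) :
    ‖embed S (Matrix.single u v c)‖ ≤ ‖c‖ := by
  have h1 : (embed S (Matrix.single u v c))ᴴ * embed S (Matrix.single u v c) =
      Matrix.diagonal fun x => if (fun i : S => x i) = v then star c * c else 0 := by
    rw [embed_conjTranspose, embed_mul, Matrix.conjTranspose_single, Matrix.single_mul_single_same]
    ext x y
    rw [embed_apply, Matrix.diagonal_apply, Matrix.single_apply]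
    by_cases hxy : x = y
    · subst hxy
      simp [eq_comm]
    · rw [if_neg hxy]
      split_ifs with h2 h3
      · refine absurd (funext fun i => ?_) hxy
        by_cases hi : i ∈ S
        · exact (congrFun h3.1 ⟨i, hi⟩).symm.trans (congrFun h3.2 ⟨i, hi⟩)
        · exact h2 i hi
      · rfl
      · rfl
  have h2 := Matrix.l2_opNorm_conjTranspose_mul_self (embed S (Matrix.single u v c))
  rw [h1, Matrix.l2_opNorm_diagonal] at h2
  refine le_of_sq_le_sq ?_ (norm_nonneg c)
  rw [sq, ← h2, pi_norm_le_iff_of_nonneg (by positivity)]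
  intro x
  split_ifs
  · rw [norm_mul, norm_star, sq]
  · rw [norm_zero]
    positivity

theorem norm_embed_le (S : Finset (Fin L)) (a : Matrix (S → Fin d) (S → Fin d) ℂ) :
    ‖embed S a‖ ≤ ∑ u, ∑ v, ‖a u v‖ := by
  have h : embed S a = ∑ u, ∑ v, embed S (Matrix.single u v (a u v)) := by
    have := congrArg (embedₗ S) (Matrix.matrix_eq_sum_single a)
    simp only [map_sum] at this
    exact this
  rw [h]
  exact norm_sum_le_of_le _ fun u _ => norm_sum_le_of_le _ fun v _ => norm_embed_single_le S u v _

/-- The operator on the sites in `S` obtained by freezing all other sites in the state `x₀`. -/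
def restrict (S : Finset (Fin L)) (x₀ : Fin d) (A : Op d L) :
    Matrix (S → Fin d) (S → Fin d) ℂ :=
  Matrix.of fun u v => A (fun i => if h : i ∈ S then u ⟨i, h⟩ else x₀)
    (fun i => if h : i ∈ S then v ⟨i, h⟩ else x₀)

theorem restrict_embed (S : Finset (Fin L)) (x₀ : Fin d)
    (a : Matrix (S → Fin d) (S → Fin d) ℂ) : restrict S x₀ (embed S a) = a := by
  ext u v
  simp +contextual [restrict, embed_apply]

/-- Operators of norm at most `ρ` that act on at most `k` sites. -/
def localOps (d L k : ℕ) (ρ : ℝ) : Set (Op d L) :=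
  {X | ∃ S : Finset (Fin L), S.card ≤ k ∧ ActsOn S X ∧ ‖X‖ ≤ ρ}

/-- The code word records the support, one of `2 ^ L` subsets, and at most `d ^ (2 * k)` matrix
entries rounded to accuracy `2 * h`. The entries of the local matrix are entries of the full
operator, so `ρ` bounds them; the norm of an error is at most the sum of its entries in modulus. -/
theorem hasCode_localOps (hd : 0 < d) (k : ℕ) {ρ h : ℝ} (hh : 0 < h) :
    HasCode (localOps d L k ρ) (d ^ (2 * k) * (2 * h))
      (2 ^ L * ((⌊2 * ρ / h⌋₊ + 1) ^ 2) ^ d ^ (2 * k)) := by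
  have x₀ : Fin d := ⟨0, hd⟩
  obtain ⟨κ, hκ, f, hc, hf⟩ := hasCode_complex (ρ := ρ) hh
  have hpow : ∀ S : Finset (Fin L), S.card ≤ k →
      Fintype.card ((S → Fin d) × (S → Fin d)) ≤ d ^ (2 * k) := fun S hS => by
    rw [Fintype.card_prod, Fintype.card_fun, Fintype.card_fin, Fintype.card_coe, ← pow_add,
      ← two_mul]
    exact Nat.pow_le_pow_right hd (by omega)
  have hS : ∀ S : Finset (Fin L), HasCode {X : Op d L | S.card ≤ k ∧ ActsOn S X ∧ ‖X‖ ≤ ρ}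
      (d ^ (2 * k) * (2 * h)) (((⌊2 * ρ / h⌋₊ + 1) ^ 2) ^ d ^ (2 * k)) := by
    intro S
    by_cases hSk : S.card ≤ k
    swap
    · refine ⟨Unit, inferInstance, fun _ => (), ?_, fun x hx => absurd hx.1 hSk⟩
      exact Nat.one_le_pow _ _ (by positivity)
    classical
    refine ⟨(S → Fin d) × (S → Fin d) → κ, inferInstance,
      fun X p => f (restrict S x₀ X p.1 p.2), ?_, fun X hX Y hY hXY => ?_⟩
    · rw [Fintype.card_fun]
      exact (Nat.pow_le_pow_left hc _).trans (Nat.pow_le_pow_right (by positivity) (hpow S hSk))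
    · obtain ⟨-, hX1, hX2⟩ := hX
      obtain ⟨-, hY1, hY2⟩ := hY
      obtain ⟨a, rfl⟩ := actsOn_iff.1 hX1
      obtain ⟨b, rfl⟩ := actsOn_iff.1 hY1
      simp only [restrict_embed] at hXY
      have hent : ∀ c : Matrix (S → Fin d) (S → Fin d) ℂ, ‖embed S c‖ ≤ ρ → ∀ u v, ‖c u v‖ ≤ ρ :=
        fun c hc u v => by
          conv_lhs => rw [← restrict_embed S x₀ c]
          exact (norm_entry_le_l2_opNorm (embed S c) _ _).trans hc
      have hsub : embed S a - embed S b = embed S (a - b) := (map_sub (embedₗ S) a b).symm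
      rw [hsub]
      refine (norm_embed_le S (a - b)).trans ?_
      calc _ ≤ ∑ _u : S → Fin d, ∑ _v : S → Fin d, 2 * h :=
            Finset.sum_le_sum fun u _ => Finset.sum_le_sum fun v _ =>
              hf _ (hent a hX2 u v) _ (hent b hY2 u v) (congrFun hXY (u, v))
        _ = (Fintype.card ((S → Fin d) × (S → Fin d)) : ℝ) * (2 * h) := by
            simp only [Finset.sum_const, Finset.card_univ, nsmul_eq_mul, Fintype.card_prod,
              Nat.cast_mul, mul_assoc]
        _ ≤ _ := by
            gcongr
            exact_mod_cast hpow S hSk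
  refine (HasCode.iUnion hS).mono ?_ le_rfl (by simp)
  rintro X ⟨S, hX⟩
  exact Set.mem_iUnion.2 ⟨S, hX⟩

end Local

/-! ### Counting circuits -/

section Circuits

variable {d L : ℕ}

open scoped Pointwise

/-- Unitary gates that act on at most `k` sites. -/
def localGates (d L k : ℕ) : Set (Op d L) :=
  {u | u ∈ Matrix.unitaryGroup (Config d L) ℂ ∧ ∃ S : Finset (Fin L), S.card ≤ k ∧ ActsOn S u}

theorem localGates_subset_unitaryGroup (d L k : ℕ) :
    localGates d L k ⊆ (Matrix.unitaryGroup (Config d L) ℂ : Set (Op d L)) := fun _ h => h.1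

theorem localGates_subset_localOps (d L k : ℕ) : localGates d L k ⊆ localOps d L k 1 :=
  fun _ ⟨h, S, hS, ha⟩ => ⟨S, hS, ha, norm_le_one_of_mem_unitaryGroup h⟩

theorem actsOn_smul_one (S : Finset (Fin L)) (c : ℂ) : ActsOn S (c • (1 : Op d L)) := by
  refine ⟨c • 1, fun x y => ?_⟩
  by_cases h : x = y
  · subst h
    simp
  · rw [Matrix.smul_apply, Matrix.one_apply_ne h, smul_zero]
    split_ifs with h1
    · rw [Matrix.smul_apply, Matrix.one_apply_ne, smul_zero]
      intro h2
      refine h (funext fun i => ?_)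
      by_cases hi : i ∈ S
      · exact congrFun h2 ⟨i, hi⟩
      · exact h1 i hi
    · rfl

theorem one_mem_localGates (d L k : ℕ) : (1 : Op d L) ∈ localGates d L k := by
  refine ⟨one_mem _, ∅, by simp, ?_⟩
  have := actsOn_smul_one (d := d) (∅ : Finset (Fin L)) 1
  rwa [one_smul] at this

theorem eq_smul_one_of_actsOn_empty {A : Op d L} (h : ActsOn ∅ A) :
    ∃ c : ℂ, A = c • (1 : Op d L) := by
  obtain ⟨a, ha⟩ := h
  have e : ∀ u v : ((∅ : Finset (Fin L)) → Fin d), u = v := fun u v => Subsingleton.elim u v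
  refine ⟨a (fun i => absurd i.2 (Finset.notMem_empty _))
    (fun i => absurd i.2 (Finset.notMem_empty _)), ?_⟩
  ext x y
  rw [ha, Matrix.smul_apply, Matrix.one_apply]
  by_cases h : x = y
  · rw [if_pos fun i _ => congrFun h i, if_pos h, smul_eq_mul, mul_one]
    congr 1 <;> exact e _ _
  · rw [if_neg fun h' => h (funext fun i => h' i (Finset.notMem_empty i)), if_neg h, smul_zero]

/-- A product of gates is, up to a phase, a product of no more gates than the total size of their
supports. -/
theorem exists_phase_smul_mem_pow (k : ℕ) : ∀ (n : ℕ) (S : Fin n → Finset (Fin L))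
    (u : Fin n → Op d L),
    (∀ i, (S i).card ≤ k ∧ ActsOn (S i) (u i) ∧ u i ∈ Matrix.unitaryGroup (Config d L) ℂ) →
    ∃ c : ℂ, c • (1 : Op d L) ∈ Matrix.unitaryGroup (Config d L) ℂ ∧
      ∃ P ∈ localGates d L k ^ (∑ i, (S i).card), (List.ofFn u).prod = c • P
  | 0, S, u, _ => ⟨1, by rw [one_smul]; exact one_mem _, 1, by simp, by simp⟩
  | n + 1, S, u, h => by
    obtain ⟨c, hc, P, hP, e⟩ :=
      exists_phase_smul_mem_pow k n (fun i => S i.succ) (fun i => u i.succ) fun i => h i.succ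
    obtain ⟨h1, h2, h3⟩ := h 0
    rw [List.ofFn_succ, List.prod_cons, e, Fin.sum_univ_succ]
    -- Empty supports are disjoint from each other, so a layer may contain any number of such gates.
    -- They are scalars and go into the phase; a gate with nonempty support is paid for by the size
    -- of its support.
    rcases (S 0).eq_empty_or_nonempty with h0 | h0
    · rw [h0] at h2
      obtain ⟨c', hc'⟩ := eq_smul_one_of_actsOn_empty h2
      refine ⟨c' * c, ?_, P, by rwa [h0, Finset.card_empty, zero_add], ?_⟩
      · have := mul_mem h3 hc
        rwa [hc', smul_mul_smul_comm, one_mul] at this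
      · rw [hc', Matrix.smul_mul, one_mul, smul_smul]
    · refine ⟨c, hc, u 0 * P, ?_, by rw [Matrix.mul_smul]⟩
      rw [pow_add]
      refine Set.mul_mem_mul ?_ hP
      have : localGates d L k ^ 1 ⊆ localGates d L k ^ (S 0).card :=
        Set.pow_subset_pow_right (one_mem_localGates d L k) h0.card_pos
      rw [pow_one] at this
      exact this ⟨h3, S 0, h1, h2⟩

/-- Disjoint supports have total size at most `L`; the extra factor is the collected phase, viewed
as a gate with empty support. -/
theorem IsLayer.mem_localGates_pow {k : ℕ} {U : Op d L} (h : IsLayer k U) :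
    U ∈ localGates d L k ^ (L + 1) := by
  obtain ⟨n, S, u, hd, hu, rfl⟩ := h
  obtain ⟨c, hc, P, hP, e⟩ := exists_phase_smul_mem_pow k n S u hu
  have hcard : ∑ i, (S i).card ≤ L := by
    rw [← Finset.card_biUnion fun i _ j _ hij => hd i j hij]
    exact (Finset.card_le_univ _).trans_eq (Fintype.card_fin L)
  rw [e, pow_succ', ← one_mul P, ← Matrix.smul_mul]
  exact Set.mul_mem_mul ⟨hc, ∅, by simp, actsOn_smul_one _ _⟩
    (Set.pow_subset_pow_right (one_mem_localGates d L k) hcard hP)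

theorem circuitUnitaries_subset (d L k D : ℕ) :
    circuitUnitaries d L k D ⊆ localGates d L k ^ ((L + 1) * D) := by
  rintro _ ⟨W, hW, rfl⟩
  rw [pow_mul]
  exact Set.mem_pow.2 ⟨fun i => ⟨W i, (hW i).mem_localGates_pow⟩, rfl⟩

theorem circuitUnitaries_subset_unitaryGroup (d L k D : ℕ) :
    circuitUnitaries d L k D ⊆ (Matrix.unitaryGroup (Config d L) ℂ : Set (Op d L)) :=
  (circuitUnitaries_subset d L k D).trans
    (pow_subset_unitaryGroup (localGates_subset_unitaryGroup d L k) _)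

theorem hasCode_circuitUnitaries (hd : 0 < d) (k D : ℕ) {h : ℝ} (hh : 0 < h) :
    HasCode (circuitUnitaries d L k D) (((L + 1) * D : ℕ) * (d ^ (2 * k) * (2 * h)))
      ((2 ^ L * ((⌊2 * 1 / h⌋₊ + 1) ^ 2) ^ d ^ (2 * k)) ^ ((L + 1) * D)) :=
  ((((hasCode_localOps hd k hh).mono (localGates_subset_localOps d L k) le_rfl le_rfl).pow
    (localGates_subset_unitaryGroup d L k) _).mono (circuitUnitaries_subset d L k D) le_rfl le_rfl)

end Circuits

/-! ### Propagators with measurable generators -/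

section Propagator

variable {ι : Type*} [Fintype ι] [DecidableEq ι]

theorem intervalIntegrable_of_bounded {G : ℝ → Matrix ι ι ℂ} {T a : ℝ}
    (hG : AEStronglyMeasurable G (volume.restrict (Set.Icc 0 T)))
    (hGa : ∀ t ∈ Set.Icc 0 T, ‖G t‖ ≤ a) {s t : ℝ} (hs : s ∈ Set.Icc 0 T)
    (ht : t ∈ Set.Icc 0 T) : IntervalIntegrable G volume s t := by
  have h : IntegrableOn G (Set.Icc 0 T) :=
    IntegrableOn.of_bound (by simp) hG a ((ae_restrict_iff' measurableSet_Icc).2 (.of_forall hGa))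
  exact (h.mono_set (Set.uIcc_subset_Icc hs ht)).intervalIntegrable

/-- `U` solves `U' = -G U`, `U 0 = 1` on `[0, T]` in integral form, for a bounded measurable
skew-Hermitian generator `G`. -/
structure IsPropagator (G U : ℝ → Matrix ι ι ℂ) (T a : ℝ) : Prop where
  aestronglyMeasurable : AEStronglyMeasurable G (volume.restrict (Set.Icc 0 T))
  norm_le : ∀ t ∈ Set.Icc 0 T, ‖G t‖ ≤ a
  skew : ∀ t ∈ Set.Icc 0 T, (G t)ᴴ = -G t
  continuousOn : ContinuousOn U (Set.Icc 0 T)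
  eq_sub : ∀ t ∈ Set.Icc 0 T, U t = 1 - ∫ s in (0 : ℝ)..t, G s * U s

namespace IsPropagator

variable {G U : ℝ → Matrix ι ι ℂ} {T a M : ℝ}

theorem intervalIntegrable (h : IsPropagator G U T a) {s t : ℝ} (hs : s ∈ Set.Icc 0 T)
    (ht : t ∈ Set.Icc 0 T) : IntervalIntegrable G volume s t :=
  intervalIntegrable_of_bounded h.aestronglyMeasurable h.norm_le hs ht

theorem intervalIntegrable_mul (h : IsPropagator G U T a) {s t : ℝ} (hs : s ∈ Set.Icc 0 T)
    (ht : t ∈ Set.Icc 0 T) : IntervalIntegrable (fun r => G r * U r) volume s t :=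
  (h.intervalIntegrable hs ht).mul_continuousOn
    (h.continuousOn.mono (Set.uIcc_subset_Icc hs ht))

theorem sub_eq (h : IsPropagator G U T a) {s t : ℝ} (hs : s ∈ Set.Icc 0 T)
    (ht : t ∈ Set.Icc 0 T) : U t - U s = -∫ r in s..t, G r * U r := by
  have h0 : (0 : ℝ) ∈ Set.Icc 0 T := ⟨le_rfl, hs.1.trans hs.2⟩
  rw [h.eq_sub t ht, h.eq_sub s hs, ← intervalIntegral.integral_interval_sub_left
    (h.intervalIntegrable_mul h0 ht) (h.intervalIntegrable_mul h0 hs)]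
  abel

theorem nonneg (h : IsPropagator G U T a) {s : ℝ} (hs : s ∈ Set.Icc 0 T) : 0 ≤ a :=
  (norm_nonneg _).trans (h.norm_le s hs)

theorem norm_sub_le (h : IsPropagator G U T a) (hM : ∀ t ∈ Set.Icc 0 T, ‖U t‖ ≤ M) {s t : ℝ}
    (hs : s ∈ Set.Icc 0 T) (ht : t ∈ Set.Icc 0 T) (hst : s ≤ t) :
    ‖U t - U s‖ ≤ a * M * (t - s) := by
  rw [h.sub_eq hs ht, norm_neg]
  have := intervalIntegral.norm_integral_le_of_norm_le_const (a := s) (b := t) (C := a * M)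
    (f := fun r => G r * U r) fun r hr => by
      rw [Set.uIoc_of_le hst] at hr
      have hr' : r ∈ Set.Icc 0 T := ⟨hs.1.trans hr.1.le, hr.2.trans ht.2⟩
      exact (norm_mul_le _ _).trans
        (mul_le_mul (h.norm_le r hr') (hM r hr') (norm_nonneg _) (h.nonneg hs))
  rwa [abs_of_nonneg (sub_nonneg.2 hst)] at this

/-- First-order expansion of the propagator. -/
theorem norm_sub_expansion_le (h : IsPropagator G U T a) (hM : ∀ t ∈ Set.Icc 0 T, ‖U t‖ ≤ M)
    {s t : ℝ} (hs : s ∈ Set.Icc 0 T) (ht : t ∈ Set.Icc 0 T) (hst : s ≤ t) :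
    ‖U t - (1 - ∫ r in s..t, G r) * U s‖ ≤ a ^ 2 * M * (t - s) ^ 2 := by
  have ha := h.nonneg hs
  have hM0 : 0 ≤ M := (norm_nonneg _).trans (hM s hs)
  have h1 : (∫ r in s..t, G r) * U s = ∫ r in s..t, G r * U s :=
    (((ContinuousLinearMap.mul ℝ (Matrix ι ι ℂ)).flip (U s)).intervalIntegral_comp_comm
      (h.intervalIntegrable hs ht)).symm
  have h2 : U t - (1 - ∫ r in s..t, G r) * U s = -∫ r in s..t, G r * (U r - U s) := by
    have h3 : IntervalIntegrable (fun r => G r * U s) volume s t :=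
      (h.intervalIntegrable hs ht).mul_continuousOn continuousOn_const
    have h4 : ∫ r in s..t, G r * (U r - U s) =
        (∫ r in s..t, G r * U r) - ∫ r in s..t, G r * U s := by
      rw [← intervalIntegral.integral_sub (h.intervalIntegrable_mul hs ht) h3]
      simp only [mul_sub]
    have h5 := h.sub_eq hs ht
    rw [h4, ← h1, sub_mul, one_mul, neg_sub, sub_eq_add_neg _ (∫ r in s..t, G r * U r), ← h5]
    abel
  rw [h2, norm_neg]
  have h3 := intervalIntegral.norm_integral_le_of_norm_le_const (a := s) (b := t)
    (C := a * (a * M * (t - s))) (f := fun r => G r * (U r - U s)) fun r hr => by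
      rw [Set.uIoc_of_le hst] at hr
      have hr' : r ∈ Set.Icc 0 T := ⟨hs.1.trans hr.1.le, hr.2.trans ht.2⟩
      refine (norm_mul_le _ _).trans
        (mul_le_mul (h.norm_le r hr') ((h.norm_sub_le hM hs hr' hr.1.le).trans ?_)
          (norm_nonneg _) ha)
      gcongr
      exact hr.2
  rw [abs_of_nonneg (sub_nonneg.2 hst)] at h3
  exact h3.trans_eq (by ring)

theorem integral_skew (h : IsPropagator G U T a) {s t : ℝ} (hs : s ∈ Set.Icc 0 T)
    (ht : t ∈ Set.Icc 0 T) : (∫ r in s..t, G r)ᴴ = -∫ r in s..t, G r := by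
  have h1 := ((starL' ℝ : Matrix ι ι ℂ ≃L[ℝ] Matrix ι ι ℂ) :
    Matrix ι ι ℂ →L[ℝ] Matrix ι ι ℂ).intervalIntegral_comp_comm (h.intervalIntegrable hs ht)
  simp only [ContinuousLinearEquiv.coe_coe, starL'_apply] at h1
  rw [← Matrix.star_eq_conjTranspose, ← h1, ← intervalIntegral.integral_neg]
  refine intervalIntegral.integral_congr fun r hr => ?_
  exact h.skew r (Set.uIcc_subset_Icc hs ht hr)

/-- The first-order terms cancel because the integrated generator is skew-Hermitian; what remains is
quadratic in the time step. -/
theorem norm_gram_sub_le (h : IsPropagator G U T a) (hM : ∀ t ∈ Set.Icc 0 T, ‖U t‖ ≤ M) {s t : ℝ}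
    (hs : s ∈ Set.Icc 0 T) (ht : t ∈ Set.Icc 0 T) (hst : s ≤ t) :
    ‖(U t)ᴴ * U t - (U s)ᴴ * U s‖ ≤ 3 * (a * M) ^ 2 * (t - s) ^ 2 := by
  have hM0 : 0 ≤ M := (norm_nonneg _).trans (hM s hs)
  set X := ∫ r in s..t, G r with hX
  set R := U t - (1 - X) * U s with hR
  have hskew : Xᴴ = -X := h.integral_skew hs ht
  have e : (U t)ᴴ * U t - (U s)ᴴ * U s =
      Rᴴ * U s + (U s)ᴴ * R + (U t - U s)ᴴ * (U t - U s) := by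
    simp only [hR, Matrix.conjTranspose_sub, Matrix.conjTranspose_mul, Matrix.conjTranspose_one,
      hskew]
    noncomm_ring
  have h1 := h.norm_sub_expansion_le hM hs ht hst
  have h2 := h.norm_sub_le hM hs ht hst
  rw [← hX, ← hR] at h1
  rw [e]
  calc _ ≤ ‖Rᴴ‖ * ‖U s‖ + ‖(U s)ᴴ‖ * ‖R‖ + ‖(U t - U s)ᴴ‖ * ‖U t - U s‖ :=
        norm_add₃_le.trans (add_le_add (add_le_add (norm_mul_le _ _) (norm_mul_le _ _))
          (norm_mul_le _ _))
    _ ≤ (a ^ 2 * M * (t - s) ^ 2) * M + M * (a ^ 2 * M * (t - s) ^ 2) +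
        (a * M * (t - s)) * (a * M * (t - s)) := by
        simp only [Matrix.l2_opNorm_conjTranspose]
        have := hM s hs
        gcongr
        exact (norm_nonneg _).trans h2
    _ = _ := by ring

/-- Since `G` is only measurable, `U` need not be differentiable everywhere. The Gram matrix `(U t)ᴴ
* U t` nevertheless has quadratically small increments, hence zero derivative everywhere, and stays
equal to `1`. -/
theorem mem_unitaryGroup (h : IsPropagator G U T a) {t : ℝ} (ht : t ∈ Set.Icc 0 T) :
    U t ∈ Matrix.unitaryGroup ι ℂ := by
  obtain ⟨M, hM⟩ := isCompact_Icc.exists_bound_of_continuousOn h.continuousOn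
  have hder : ∀ s ∈ Set.Icc 0 T,
      HasDerivWithinAt (fun r => (U r)ᴴ * U r) 0 (Set.Icc 0 T) s := by
    intro s hs
    have h1 : HasFDerivWithinAt (fun r => (U r)ᴴ * U r - (U s)ᴴ * U s)
        (0 : ℝ →L[ℝ] Matrix ι ι ℂ) (Set.Icc 0 T) s := by
      refine Asymptotics.IsBigO.hasFDerivWithinAt (n := 2) ?_ hs one_lt_two
      refine Asymptotics.IsBigO.of_bound (3 * (a * M) ^ 2)
        (eventually_nhdsWithin_of_forall fun r hr => ?_)
      rw [Real.norm_eq_abs, Real.norm_eq_abs, sq_abs, abs_of_nonneg (sq_nonneg _)]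
      rcases le_total s r with hsr | hsr
      · exact h.norm_gram_sub_le hM hs hr hsr
      · rw [norm_sub_rev, ← neg_sub s r, neg_sq]
        exact h.norm_gram_sub_le hM hr hs hsr
    have h2 := (h1.add_const ((U s)ᴴ * U s)).hasDerivWithinAt
    simpa using h2
  have hconst := constant_of_derivWithin_zero (fun s hs => (hder s hs).differentiableWithinAt)
    (fun s hs => by
      rcases (hs.1.trans hs.2.le).eq_or_lt with h0 | h0
      · exact absurd (hs.1.trans_lt hs.2) (by rw [h0]; exact lt_irrefl _)
      · exact (hder s ⟨hs.1, hs.2.le⟩).derivWithin (uniqueDiffOn_Icc h0 s ⟨hs.1, hs.2.le⟩)) t ht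
  have h0 : U 0 = 1 := by
    rw [h.eq_sub 0 ⟨le_rfl, ht.1.trans ht.2⟩, intervalIntegral.integral_same, sub_zero]
  rw [Matrix.mem_unitaryGroup_iff', Matrix.star_eq_conjTranspose]
  simpa [h0] using hconst

/-- The propagator over a short time interval is close to its first-order expansion. -/
theorem norm_step_sub_le (h : IsPropagator G U T a) {s t : ℝ}
    (hs : s ∈ Set.Icc 0 T) (ht : t ∈ Set.Icc 0 T) (hst : s ≤ t) :
    ‖U t * (U s)ᴴ - (1 - ∫ r in s..t, G r)‖ ≤ (a * (t - s)) ^ 2 := by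
  have hU := h.mem_unitaryGroup hs
  have h1 := h.norm_sub_expansion_le (M := 1)
    (fun r hr => norm_le_one_of_mem_unitaryGroup (h.mem_unitaryGroup hr)) hs ht hst
  have e : U t * (U s)ᴴ - (1 - ∫ r in s..t, G r) =
      (U t - (1 - ∫ r in s..t, G r) * U s) * (U s)ᴴ := by
    have := unitaryGroup_mul_conjTranspose ⟨U s, hU⟩
    simp only at this
    rw [Matrix.sub_mul, Matrix.mul_assoc, this, Matrix.mul_one]
  rw [e]
  calc _ ≤ ‖U t - (1 - ∫ r in s..t, G r) * U s‖ * ‖(U s)ᴴ‖ := norm_mul_le _ _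
    _ ≤ (a ^ 2 * 1 * (t - s) ^ 2) * 1 := by
        rw [Matrix.l2_opNorm_conjTranspose]
        have := norm_le_one_of_mem_unitaryGroup hU
        gcongr
    _ = _ := by ring

end IsPropagator

end Propagator

/-! ### Counting time evolutions -/

section Evolution

variable {d L : ℕ}

open scoped Pointwise

/-- Unitaries that are close to the first-order expansion of the evolution during a time step, for
`K` local terms whose time integrals have norm at most `ρ`. -/
def stepUnitaries (d L k K : ℕ) (ρ : ℝ) : Set (Op d L) :=
  {u | u ∈ Matrix.unitaryGroup (Config d L) ℂ ∧ ∃ X ∈ K • localOps d L k ρ,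
    ‖u - (1 - Complex.I • X)‖ ≤ (K * ρ) ^ 2}

theorem hasCode_stepUnitaries (hd : 0 < d) (k K : ℕ) (ρ : ℝ) {h : ℝ} (hh : 0 < h) :
    HasCode (stepUnitaries d L k K ρ) (K * (d ^ (2 * k) * (2 * h)) + 2 * (K * ρ) ^ 2)
      ((2 ^ L * ((⌊2 * ρ / h⌋₊ + 1) ^ 2) ^ d ^ (2 * k)) ^ K) := by
  refine ((hasCode_localOps hd k hh).nsmul K).of_approx (fun X => 1 - Complex.I • X)
    (fun X _ Y _ => ?_) fun u hu => hu.2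
  rw [sub_sub_sub_cancel_left, ← smul_sub, norm_smul, Complex.norm_I, one_mul, norm_sub_rev]

/-- Restricting to `S` and embedding again is a linear map that fixes the operators acting on `S`;
it commutes with the integral. -/
theorem ActsOn.intervalIntegral (hd : 0 < d) {S : Finset (Fin L)} {h : ℝ → Op d L} {s t : ℝ}
    (hS : ∀ r ∈ Set.uIcc s t, ActsOn S (h r)) (hi : IntervalIntegrable h volume s t) :
    ActsOn S (∫ r in s..t, h r) := by
  let φ : Op d L →ₗ[ℂ] Op d L := embedₗ S ∘ₗ
    { toFun := restrict S ⟨0, hd⟩, map_add' := fun _ _ => rfl, map_smul' := fun _ _ => rfl }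
  have h1 := (LinearMap.toContinuousLinearMap φ).intervalIntegral_comp_comm hi
  have h2 : ∫ r in s..t, (LinearMap.toContinuousLinearMap φ) (h r) = ∫ r in s..t, h r := by
    refine intervalIntegral.integral_congr fun r hr => ?_
    obtain ⟨a, ha⟩ := actsOn_iff.1 (hS r hr)
    change embed S (restrict S ⟨0, hd⟩ (h r)) = h r
    rw [ha, restrict_embed]
  rw [h2] at h1
  exact actsOn_iff.2 ⟨_, h1⟩

theorem ActsOn.smul {S : Finset (Fin L)} {A : Op d L} (h : ActsOn S A) (c : ℂ) :
    ActsOn S (c • A) := by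
  obtain ⟨a, rfl⟩ := actsOn_iff.1 h
  exact actsOn_iff.2 ⟨c • a, ((embedₗ S).map_smul c a).symm⟩

/-- The interval is cut into `n` equal steps, and `U T` telescopes into the products `U t * (U s)ᴴ`.
To first order a step depends on `h` only through the integrals of the local terms, which keep their
supports, so no regularity in time is needed. -/
theorem evolutionUnitaries_subset (hd : 0 < d) (k K n : ℕ) {ħ J T : ℝ} (hħ : 0 < ħ)
    (hT : 0 ≤ T) (hn : 0 < n) :
    evolutionUnitaries d L k K ħ J T ⊆ stepUnitaries d L k K (J * (T / n)) ^ n := by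
  rintro _ ⟨S, h, U, hk, hh, hmeas, hU, heq, rfl⟩
  set c : ℂ := (ħ : ℂ)⁻¹ with hc
  have hcn : ‖c‖ = ħ⁻¹ := by rw [hc, norm_inv, Complex.norm_real, Real.norm_of_nonneg hħ.le]
  have hhn : ∀ i, ∀ t ∈ Set.Icc 0 T, ‖c • h i t‖ ≤ J := fun i t ht => by
    rw [norm_smul, hcn, mul_comm, ← div_eq_mul_inv]
    exact (hh i t ht).2.2
  have hprop : IsPropagator (fun t => Complex.I • ∑ i, c • h i t) U T (K * J) := by
    refine ⟨?_, fun t ht => ?_, fun t ht => ?_, hU, fun t ht => ?_⟩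
    · have h1 : AEStronglyMeasurable (fun t => ∑ i, c • h i t) (volume.restrict (Set.Icc 0 T)) :=
        Finset.aestronglyMeasurable_fun_sum _ fun i _ => (hmeas i).const_smul c
      exact h1.const_smul Complex.I
    · rw [norm_smul, Complex.norm_I, one_mul]
      refine (norm_sum_le_of_le _ fun i _ => hhn i t ht).trans ?_
      simp
    · simp only [Matrix.conjTranspose_smul, Matrix.conjTranspose_sum, hc]
      rw [← neg_smul]
      congr 1
      · simp
      · refine Finset.sum_congr rfl fun i _ => ?_
        rw [(hh i t ht).2.1.eq]
        simp
    · rw [heq t ht, ← intervalIntegral.integral_smul]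
      congr 2
      ext1 s
      rw [← Finset.smul_sum, smul_smul, Matrix.smul_mul, hc, div_eq_mul_inv]
  set τ : ℝ := T / n with hτ
  have hτ0 : 0 ≤ τ := by positivity
  have hn' : (0 : ℝ) < n := by exact_mod_cast hn
  have hgrid : ∀ m : ℕ, m ≤ n → (m : ℝ) * τ ∈ Set.Icc 0 T := fun m hm => by
    refine ⟨by positivity, ?_⟩
    have : (m : ℝ) ≤ n := by exact_mod_cast hm
    calc (m : ℝ) * τ ≤ n * τ := by gcongr
      _ = T := by rw [hτ]; field_simp
  have hstep : ∀ m : ℕ, m + 1 ≤ n →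
      U ((m + 1 : ℕ) * τ) * (U (m * τ))ᴴ ∈ stepUnitaries d L k K (J * τ) := by
    intro m hm
    have hs := hgrid m (by omega)
    have ht := hgrid (m + 1) hm
    have hst : (m : ℝ) * τ ≤ (m + 1 : ℕ) * τ := by gcongr; omega
    have hdiff : ((m + 1 : ℕ) : ℝ) * τ - m * τ = τ := by push_cast; ring
    have hsub := Set.uIcc_subset_Icc hs ht
    have hint : ∀ i, IntervalIntegrable (fun r => c • h i r) volume (m * τ) ((m + 1 : ℕ) * τ) :=
      fun i => intervalIntegrable_of_bounded ((hmeas i).const_smul c) (hhn i) hs ht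
    refine ⟨mul_mem (hprop.mem_unitaryGroup ht) (Unitary.star_mem (hprop.mem_unitaryGroup hs)),
      ∑ i, ∫ r in (m * τ)..((m + 1 : ℕ) * τ), c • h i r, ?_, ?_⟩
    · have hmem := Set.finsetSum_mem_finsetSum (Finset.univ : Finset (Fin K))
        (fun _ => localOps d L k (J * τ))
        (fun i => ∫ r in (m * τ)..((m + 1 : ℕ) * τ), c • h i r) fun i _ => by
          refine ⟨S i, hk i, ActsOn.intervalIntegral hd
            (fun r hr => (hh i r (hsub hr)).1.smul c) (hint i), ?_⟩
          have := intervalIntegral.norm_integral_le_of_norm_le_const (C := J) (a := m * τ)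
            (b := (m + 1 : ℕ) * τ) (f := fun r => c • h i r)
            fun r hr => hhn i r (hsub (Set.uIoc_subset_uIcc hr))
          rwa [hdiff, abs_of_nonneg hτ0] at this
      rwa [Finset.sum_const, Finset.card_univ, Fintype.card_fin] at hmem
    · have := hprop.norm_step_sub_le hs ht hst
      rwa [hdiff, intervalIntegral.integral_smul,
        intervalIntegral.integral_finsetSum fun i _ => hint i, mul_assoc] at this
  have hpow : ∀ m : ℕ, m ≤ n → U (m * τ) ∈ stepUnitaries d L k K (J * τ) ^ m := by
    intro m
    induction m with
    | zero =>
      intro _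
      rw [pow_zero, Set.mem_one, Nat.cast_zero, zero_mul, hprop.eq_sub 0 ⟨le_rfl, hT⟩,
        intervalIntegral.integral_same, sub_zero]
    | succ m ih =>
      intro hm
      rw [pow_succ']
      have := unitaryGroup_conjTranspose_mul
        ⟨U (m * τ), hprop.mem_unitaryGroup (hgrid m (by omega))⟩
      refine ⟨_, hstep m hm, _, ih (by omega), ?_⟩
      simp only at this ⊢
      rw [mul_assoc, this, mul_one]
  have := hpow n le_rfl
  rwa [show (n : ℝ) * τ = T by rw [hτ]; field_simp] at this

theorem stepUnitaries_subset_unitaryGroup (d L k K : ℕ) (ρ : ℝ) :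
    stepUnitaries d L k K ρ ⊆ (Matrix.unitaryGroup (Config d L) ℂ : Set (Op d L)) :=
  fun _ h => h.1

theorem hasCode_evolutionUnitaries (hd : 0 < d) (k K n : ℕ) {ħ J T h : ℝ} (hħ : 0 < ħ)
    (hT : 0 ≤ T) (hn : 0 < n) (hh : 0 < h) :
    HasCode (evolutionUnitaries d L k K ħ J T)
      (n * (K * (d ^ (2 * k) * (2 * h)) + 2 * (K * (J * (T / n))) ^ 2))
      (((2 ^ L * ((⌊2 * (J * (T / n)) / h⌋₊ + 1) ^ 2) ^ d ^ (2 * k)) ^ K) ^ n) :=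
  ((hasCode_stepUnitaries hd k K _ hh).pow (stepUnitaries_subset_unitaryGroup d L k K _) n).mono
    (evolutionUnitaries_subset hd k K n hħ hT hn) le_rfl le_rfl

theorem evolutionUnitaries_subset_unitaryGroup (hd : 0 < d) (k K : ℕ) {ħ J T : ℝ} (hħ : 0 < ħ)
    (hT : 0 ≤ T) :
    evolutionUnitaries d L k K ħ J T ⊆ (Matrix.unitaryGroup (Config d L) ℂ : Set (Op d L)) :=
  (evolutionUnitaries_subset hd k K 1 hħ hT one_pos).trans
    (pow_subset_unitaryGroup (stepUnitaries_subset_unitaryGroup d L k K _) 1)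

theorem evolutionUnitaries_mono (d L k K : ℕ) (ħ T : ℝ) {J J' : ℝ} (hJ : J ≤ J') :
    evolutionUnitaries d L k K ħ J T ⊆ evolutionUnitaries d L k K ħ J' T := by
  rintro V ⟨S, h, U, hk, hh, hrest⟩
  exact ⟨S, h, U, hk, fun i t ht => ⟨(hh i t ht).1, (hh i t ht).2.1,
    (hh i t ht).2.2.trans hJ⟩, hrest⟩

end Evolution

/-! ### Asymptotic estimates -/

section Asymptotics

theorem eventually_mul_rpow_le_pow (B : ℝ) {β : ℝ} {q : ℕ} (hq : β + 1 ≤ q) :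
    ∀ᶠ L : ℕ in atTop, B * (L : ℝ) ^ β ≤ (L : ℝ) ^ q := by
  filter_upwards [eventually_ge_atTop 1, eventually_ge_atTop ⌈B⌉₊] with L h1 hB
  have h1' : (1 : ℝ) ≤ L := by exact_mod_cast h1
  calc B * (L : ℝ) ^ β ≤ L * (L : ℝ) ^ β := by
        gcongr
        exact Nat.ceil_le.1 hB
    _ = (L : ℝ) ^ (β + 1) := by
        rw [Real.rpow_add (by linarith), Real.rpow_one, mul_comm]
    _ ≤ (L : ℝ) ^ (q : ℝ) := Real.rpow_le_rpow_of_exponent_le h1' hq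
    _ = (L : ℝ) ^ q := Real.rpow_natCast _ _

theorem card_code_le_exp {L t e : ℕ} {x : ℝ} (hL : 2 ≤ L) (hLe : 1 + 2 * (t + 1) * e ≤ L)
    (hx : x ≤ (L : ℝ) ^ t) :
    ((2 ^ L * ((⌊x⌋₊ + 1) ^ 2) ^ e : ℕ) : ℝ) ≤ Real.exp ((L : ℝ) ^ 2) := by
  have hfl : ⌊x⌋₊ + 1 ≤ L ^ (t + 1) := by
    have h1 : ⌊x⌋₊ ≤ L ^ t := by
      have := Nat.floor_le_floor hx
      rwa [← Nat.cast_pow, Nat.floor_natCast] at this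
    have h2 : 1 ≤ L ^ t := Nat.one_le_pow _ _ (by omega)
    calc ⌊x⌋₊ + 1 ≤ L ^ t * 2 := by omega
      _ ≤ L ^ t * L := Nat.mul_le_mul_left _ hL
      _ = L ^ (t + 1) := (pow_succ _ _).symm
  have hexp : (L : ℝ) ≤ Real.exp L := by linarith [Real.add_one_le_exp (L : ℝ)]
  have h2exp : (2 : ℝ) ≤ Real.exp 1 := by linarith [Real.add_one_le_exp (1 : ℝ)]
  calc ((2 ^ L * ((⌊x⌋₊ + 1) ^ 2) ^ e : ℕ) : ℝ)
      ≤ ((2 ^ L * ((L ^ (t + 1)) ^ 2) ^ e : ℕ) : ℝ) := by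
        have : 2 ^ L * ((⌊x⌋₊ + 1) ^ 2) ^ e ≤ 2 ^ L * ((L ^ (t + 1)) ^ 2) ^ e := by gcongr
        exact_mod_cast this
    _ = (2 : ℝ) ^ L * (L : ℝ) ^ (2 * (t + 1) * e) := by
        push_cast
        rw [← pow_mul, ← pow_mul]
        congr 2
        ring
    _ ≤ Real.exp 1 ^ L * Real.exp L ^ (2 * (t + 1) * e) := by gcongr
    _ = Real.exp ((L : ℝ) * (1 + 2 * (t + 1) * e : ℕ)) := by
        rw [← Real.exp_nat_mul, ← Real.exp_nat_mul, ← Real.exp_add]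
        congr 1
        push_cast
        ring
    _ ≤ Real.exp ((L : ℝ) ^ 2) := by
        rw [sq]
        gcongr

variable {d : ℕ}

theorem eventually_hasCode_circuitUnitaries (hd : 0 < d) (k q : ℕ) :
    ∃ r : ℕ, ∀ᶠ L : ℕ in atTop, ∀ D : ℕ, (D : ℝ) ≤ (L : ℝ) ^ q → ∃ m : ℕ,
      (m : ℝ) ≤ Real.exp ((L : ℝ) ^ r) ∧
      HasCode (circuitUnitaries d L k D) (((L : ℝ) ^ (q + 1))⁻¹) m := by
  -- The mesh is `L ^ (-t)`. The total error is at most `L ^ (q + 4 - t)`, which has to equal `L ^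
  -- (-(q + 1))`.
  obtain ⟨t, ht⟩ : ∃ t, t = 2 * q + 5 := ⟨_, rfl⟩
  refine ⟨q + 4, ?_⟩
  filter_upwards [eventually_ge_atTop 2, eventually_ge_atTop (d ^ (2 * k)),
    eventually_ge_atTop (1 + 2 * (t + 1 + 1) * d ^ (2 * k))] with L h2 hdL htL D hD
  have h2' : (2 : ℝ) ≤ L := by exact_mod_cast h2
  have hL0 : (0 : ℝ) < L := by linarith
  have hdL' : (d : ℝ) ^ (2 * k) ≤ L := by exact_mod_cast hdL
  have hL1 : (L : ℝ) + 1 ≤ (L : ℝ) ^ 2 := by nlinarith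
  have hh : (0 : ℝ) < ((L : ℝ) ^ t)⁻¹ := by positivity
  have hlen : (((L + 1) * D : ℕ) : ℝ) ≤ (L : ℝ) ^ (q + 2) := by
    push_cast
    calc ((L : ℝ) + 1) * D ≤ (L : ℝ) ^ 2 * (L : ℝ) ^ q := by gcongr
      _ = _ := by ring
  refine ⟨_, ?_, (hasCode_circuitUnitaries hd k D hh).mono subset_rfl ?_ le_rfl⟩
  · have hx : 2 * 1 / ((L : ℝ) ^ t)⁻¹ ≤ (L : ℝ) ^ (t + 1) := by
      rw [div_inv_eq_mul, mul_one, pow_succ']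
      gcongr
    rw [Nat.cast_pow]
    calc _ ≤ Real.exp ((L : ℝ) ^ 2) ^ ((L + 1) * D) := by
          gcongr
          exact card_code_le_exp h2 htL hx
      _ = Real.exp (((L + 1) * D : ℕ) * (L : ℝ) ^ 2) := (Real.exp_nat_mul _ _).symm
      _ ≤ Real.exp ((L : ℝ) ^ (q + 2) * (L : ℝ) ^ 2) := by gcongr
      _ = _ := by ring_nf
  · calc _ ≤ (L : ℝ) ^ (q + 2) * ((L : ℝ) * (L * ((L : ℝ) ^ t)⁻¹)) := by gcongr
      _ ≤ ((L : ℝ) ^ (q + 1))⁻¹ := by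
        rw [ht, le_inv_comm₀ (by positivity) (by positivity)]
        have : (L : ℝ) ^ (q + 2) * ((L : ℝ) * (L * ((L : ℝ) ^ (2 * q + 5))⁻¹)) =
            ((L : ℝ) ^ (q + 1))⁻¹ := by
          field_simp
          ring
        rw [this, inv_inv]

theorem eventually_hasCode_evolutionUnitaries (hd : 0 < d) (k q : ℕ) :
    ∃ r : ℕ, ∀ᶠ L : ℕ in atTop, ∀ (K : ℕ) (ħ J T : ℝ), 0 < ħ → 0 ≤ T → (K : ℝ) ≤ (L : ℝ) ^ q →
      J ≤ (L : ℝ) ^ q → T ≤ (L : ℝ) ^ q → ∃ m : ℕ,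
      (m : ℝ) ≤ Real.exp ((L : ℝ) ^ r) ∧
      HasCode (evolutionUnitaries d L k K ħ J T) (((L : ℝ) ^ (q + 1))⁻¹) m := by
  -- With `L ^ s` time steps and mesh `L ^ (-t)`, the expansion error is at most `L ^ (6 * q + 1 -
  -- s)` and the rounding error at most `L ^ (s + q + 2 - t)`. Both exponents are made equal to `-(q
  -- + 2)`, and the spare factor `L` absorbs the sum of the two.
  obtain ⟨s, hs⟩ : ∃ s, s = 7 * q + 3 := ⟨_, rfl⟩
  obtain ⟨t, ht⟩ : ∃ t, t = s + 2 * q + 4 := ⟨_, rfl⟩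
  refine ⟨q + s + 2, ?_⟩
  filter_upwards [eventually_ge_atTop 2, eventually_ge_atTop (d ^ (2 * k)),
    eventually_ge_atTop (1 + 2 * (t + 2 * q + 1 + 1) * d ^ (2 * k))]
    with L h2 hdL htL K ħ J T hħ hT hK hJ hTL
  have h2' : (2 : ℝ) ≤ L := by exact_mod_cast h2
  have hL0 : (0 : ℝ) < L := by linarith
  have hdL' : (d : ℝ) ^ (2 * k) ≤ L := by exact_mod_cast hdL
  have hh : (0 : ℝ) < ((L : ℝ) ^ t)⁻¹ := by positivity
  have hn : 0 < L ^ s := by positivity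
  refine ⟨_, ?_, (hasCode_evolutionUnitaries hd k K (L ^ s) hħ hT hn hh).mono
    (evolutionUnitaries_mono d L k K ħ T hJ) ?_ le_rfl⟩
  · have hx : 2 * ((L : ℝ) ^ q * (T / (L ^ s : ℕ))) / ((L : ℝ) ^ t)⁻¹ ≤
        (L : ℝ) ^ (t + 2 * q + 1) := by
      have h1 : T / (L ^ s : ℕ) ≤ (L : ℝ) ^ q :=
        (div_le_self hT (by exact_mod_cast hn)).trans hTL
      rw [div_inv_eq_mul]
      calc _ ≤ (L : ℝ) * ((L : ℝ) ^ q * (L : ℝ) ^ q) * (L : ℝ) ^ t := by gcongr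
        _ = _ := by ring
    rw [Nat.cast_pow, Nat.cast_pow]
    calc _ ≤ (Real.exp ((L : ℝ) ^ 2) ^ K) ^ (L ^ s) := by
          gcongr
          exact card_code_le_exp h2 htL hx
      _ = Real.exp ((K * L ^ s : ℕ) * (L : ℝ) ^ 2) := by
          rw [← pow_mul, ← Real.exp_nat_mul]
      _ ≤ Real.exp (((L : ℝ) ^ q * (L : ℝ) ^ s) * (L : ℝ) ^ 2) := by
          push_cast
          gcongr
      _ = _ := by ring_nf
  · push_cast
    have h1 : ((L : ℝ) ^ s) * (K * (d ^ (2 * k) * (2 * ((L : ℝ) ^ t)⁻¹))) ≤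
        ((L : ℝ) ^ (q + 2))⁻¹ := by
      calc _ ≤ ((L : ℝ) ^ s) * ((L : ℝ) ^ q * (L * (L * ((L : ℝ) ^ t)⁻¹))) := by gcongr
        _ = _ := by
          rw [ht]
          field_simp
          ring
    have h3 : ((L : ℝ) ^ s) * (2 * (K * ((L : ℝ) ^ q * (T / (L : ℝ) ^ s))) ^ 2) ≤
        ((L : ℝ) ^ (q + 2))⁻¹ := by
      calc _ ≤ ((L : ℝ) ^ s) * (L *
            ((L : ℝ) ^ q * ((L : ℝ) ^ q * ((L : ℝ) ^ q / (L : ℝ) ^ s))) ^ 2) := by gcongr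
        _ = _ := by
          rw [hs]
          field_simp
          ring
    calc _ ≤ ((L : ℝ) ^ (q + 2))⁻¹ + ((L : ℝ) ^ (q + 2))⁻¹ := by
          rw [mul_add]
          exact add_le_add h1 h3
      _ = 2 * ((L : ℝ) ^ (q + 2))⁻¹ := by ring
      _ ≤ L * ((L : ℝ) ^ (q + 2))⁻¹ := by gcongr
      _ = _ := by
          field_simp
          ring

/-- With `y = exp (c / 2 * L)` the power of two is at least `exp (log 2 * y ^ 2)`, and `L ^ r + y ≤
2 * y ≤ log 2 * y ^ 2` once `L ^ r ≤ y` and `y ≥ 4`. -/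
theorem eventually_exp_le_two_pow {c : ℝ} (hc : 0 < c) (r : ℕ) :
    ∀ᶠ L : ℕ in atTop, Real.exp ((L : ℝ) ^ r) ≤
      Real.exp (-Real.exp (c / 2 * L)) * 2 ^ ⌈Real.exp (c * L)⌉₊ := by
  have hc2 : 0 < c / 2 := by linarith
  have h1 := (isLittleO_pow_exp_pos_mul_atTop (k := r) hc2).bound one_pos
  have h2 := (Real.tendsto_exp_atTop.comp
    (tendsto_id.const_mul_atTop hc2)).eventually_ge_atTop (4 : ℝ)
  filter_upwards [tendsto_natCast_atTop_atTop.eventually h1,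
    tendsto_natCast_atTop_atTop.eventually h2] with L h1 h2
  simp only [Function.comp, id] at h2
  rw [one_mul, Real.norm_of_nonneg (by positivity), Real.norm_of_nonneg (by positivity)] at h1
  set y := Real.exp (c / 2 * L) with hy
  have hy2 : Real.exp (c * L) = y * y := by
    rw [hy, ← Real.exp_add]
    congr 1
    ring
  have h3 : Real.exp (Real.log 2 * (y * y)) ≤ 2 ^ ⌈Real.exp (c * L)⌉₊ := by
    rw [← Real.rpow_natCast, Real.rpow_def_of_pos two_pos]
    have := Nat.le_ceil (Real.exp (c * L))
    rw [← hy2]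
    have := Real.log_nonneg (one_le_two (α := ℝ))
    gcongr
  refine le_trans ?_ (mul_le_mul_of_nonneg_left h3 (Real.exp_pos _).le)
  rw [← Real.exp_add]
  have := Real.log_two_gt_d9
  gcongr
  nlinarith

end Asymptotics

end QuditSystem

/-! ### The main theorem -/

theorem mainTheorem4 (Δ : ℝ) (hΔ : 0 < Δ) :
    ∃ ε₀ : ℝ≥0, 0 < ε₀ ∧ ∀ ε : ℝ≥0, 0 < ε → ε ≤ ε₀ →
    ∀ d k : ℕ, 2 ≤ d → ∀ α C c : ℝ, 0 < α → 0 < c →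
    ∃ c' : ℝ, 0 < c' ∧ ∀ B β : ℝ, ∀ᶠ L : ℕ in atTop,
    ∀ (ω : Fin (d ^ L) → ℝ) (ω₁ ω₂ : ℝ),
      QuditSystem.spectralWidth ω ≤ C * (L : ℝ) ^ α →
      Δ ≤ ω₂ - ω₁ →
      Real.exp (c * L) ≤ QuditSystem.numEigenvaluesNear ω ω₁ (ε / 2) →
      Real.exp (c * L) ≤ QuditSystem.numEigenvaluesNear ω ω₂ (ε / 2) →
      ENNReal.ofReal (Real.exp (Real.exp (c' * L))) ≤
          (Metric.coveringNumber ε (QuditSystem.observablesWithSpectrum ω) : ℝ≥0∞) ∧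
      (∀ D : ℕ, (D : ℝ) ≤ B * (L : ℝ) ^ β →
        QuditSystem.GenericallyUnreachable ω (QuditSystem.circuitUnitaries d L k D) ε
          (Real.exp (-Real.exp (c' * L)))) ∧
      (∀ (K : ℕ) (ħ J T : ℝ), 0 < ħ → 0 ≤ T → (K : ℝ) ≤ B * (L : ℝ) ^ β →
        J ≤ B * (L : ℝ) ^ β → T ≤ B * (L : ℝ) ^ β →
        QuditSystem.GenericallyUnreachable ω (QuditSystem.evolutionUnitaries d L k K ħ J T) ε
          (Real.exp (-Real.exp (c' * L)))) := by
  refine ⟨⟨Δ / 10, by positivity⟩, by exact_mod_cast div_pos hΔ (by norm_num), ?_⟩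
  intro ε hε hεΔ d k hd α C c hα hc
  refine ⟨c / 2, by linarith, fun B β => ?_⟩
  have hεΔ' : (ε : ℝ) ≤ Δ / 10 := hεΔ
  have hε' : (0 : ℝ) < ε := hε
  have hd0 : 0 < d := by omega
  obtain ⟨q, hqα, hqβ⟩ : ∃ q : ℕ, α + 1 ≤ q ∧ β + 1 ≤ q := by
    obtain ⟨q, hq⟩ := exists_nat_ge (max (α + 1) (β + 1))
    exact ⟨q, (le_max_left _ _).trans hq, (le_max_right _ _).trans hq⟩
  obtain ⟨r₁, hr₁⟩ := QuditSystem.eventually_hasCode_circuitUnitaries hd0 k q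
  obtain ⟨r₂, hr₂⟩ := QuditSystem.eventually_hasCode_evolutionUnitaries hd0 k q
  filter_upwards [hr₁, hr₂, QuditSystem.eventually_mul_rpow_le_pow C hqα,
    QuditSystem.eventually_mul_rpow_le_pow B hqβ, QuditSystem.eventually_exp_le_two_pow hc r₁,
    QuditSystem.eventually_exp_le_two_pow hc r₂, eventually_ge_atTop 1,
    eventually_ge_atTop ⌈(ε : ℝ)⌉₊, eventually_ge_atTop ⌈4 / (ε : ℝ)⌉₊]
    with L hcirc hevol hCL hBL he₁ he₂ h1 hLε hLε' ω ω₁ ω₂ hw hω hn₁ hn₂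
  replace hn₁ := Nat.ceil_le.2 hn₁
  replace hn₂ := Nat.ceil_le.2 hn₂
  have hω' : 10 * (ε : ℝ) ≤ ω₂ - ω₁ := by linarith
  have h1' : (1 : ℝ) ≤ L := by exact_mod_cast h1
  have hq0 : q ≠ 0 := by
    rintro rfl
    norm_num at hqα
    linarith
  -- Both the spectral width and `ε` are at most `L ^ q`, so the left-hand side is at most `4 / L`.
  have hη : 2 * (QuditSystem.spectralWidth ω + ε) * ((L : ℝ) ^ (q + 1))⁻¹ ≤ ε := by
    have hLq : (L : ℝ) ≤ (L : ℝ) ^ q := le_self_pow₀ h1' hq0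
    have h2 : QuditSystem.spectralWidth ω + ε ≤ 2 * (L : ℝ) ^ q := by
      linarith [Nat.ceil_le.1 hLε]
    have h3 : 4 ≤ ε * (L : ℝ) := by
      have := Nat.ceil_le.1 hLε'
      rwa [div_le_iff₀' hε'] at this
    rw [mul_inv_le_iff₀ (by positivity), pow_succ]
    have : (0 : ℝ) < (L : ℝ) ^ q := by positivity
    calc _ ≤ 4 * (L : ℝ) ^ q := by linarith
      _ ≤ ε * (L : ℝ) * (L : ℝ) ^ q := by gcongr
      _ = _ := by ring
  have hδ : Real.exp (-Real.exp (c / 2 * L)) < 1 :=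
    Real.exp_lt_one_iff.2 (neg_lt_zero.2 (Real.exp_pos _))
  refine ⟨?_, fun D hD => ?_, fun K ħ J T hħ hT hK hJ hTL => ?_⟩
  · refine le_trans ?_ (QuditSystem.two_pow_le_coveringNumber hε hω' hn₁ hn₂)
    -- The comparison `he₁` is reused with its left-hand side weakened to `1`.
    have h2 : Real.exp (Real.exp (c / 2 * L)) ≤ 2 ^ ⌈Real.exp (c * L)⌉₊ := by
      have h3 := (Real.one_le_exp (by positivity)).trans he₁
      rwa [Real.exp_neg, inv_mul_eq_div, one_le_div (Real.exp_pos _)] at h3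
    have := ENNReal.ofReal_le_ofReal h2
    rwa [ENNReal.ofReal_pow (by norm_num), ENNReal.ofReal_ofNat] at this
  · obtain ⟨m, hm, hcode⟩ := hcirc D (hD.trans hBL)
    exact QuditSystem.genericallyUnreachable_of_hasCode hε hω' hn₁ hn₂
      (QuditSystem.circuitUnitaries_subset_unitaryGroup d L k D) hcode hη hδ (hm.trans he₁)
  · obtain ⟨m, hm, hcode⟩ := hevol K ħ J T hħ hT (hK.trans hBL) (hJ.trans hBL) (hTL.trans hBL)
    exact QuditSystem.genericallyUnreachable_of_hasCode hε hω' hn₁ hn₂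
      (QuditSystem.evolutionUnitaries_subset_unitaryGroup hd0 k K hħ hT) hcode hη hδ
      (hm.trans he₂)
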